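/- **Setting.** An architecture has finitely many system processes; process $p_j$ has finite sets of Boolean variables $I_j$ (inputs) and $O_j$ (outputs) with $I_j\cap O_j=\emptyset$ and $O_j\cap O_k=\emptyset$ for $j\ne k$; $V_j=I_j\cup O_j$. The parallel composition of a nonempty set $S$ of system processes has outputs $O_S=\bigcup_{j\in S}O_j$ and inputs $I_S=\bigcup_{j\in S}I_j\setminus O_S$. A strategy for a (composed) process with inputs $I$ and outputs $O$ is a finite Moore machine $(T,t_0,\tau,o)$, $\tau:T\times 2^I\to T$, $o:T\to 2^O$; its computation on $\gamma\in(2^I)^\omega$ is $\mathrm{comp}(s,\gamma)=(\gamma_0\cup o(t_0))(\gamma_1\cup o(t_1))\dots$ with $t_{n+1}=\tau(t_n,\gamma_n)$. For strategies $s_1,s_2$ of $p_1\neq p_2$, the parallel composition $s_1\,||\,s_2$ is the Moore machine with inputs $(I_1\cup I_2)\setminus(O_1\cup O_2)$, outputs $O_1\cup O_2$, states $T_1\times T_2$, initial state the pair of initial states, $\tau((t,t'),\iota)=(\tau_1(t,(\iota\cup o_2(t'))\cap I_1),\ \tau_2(t',(\iota\cup o_1(t))\cap I_2))$ and $o((t,t'))=o_1(t)\cup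 o_2(t')$. An alternating co-Büchi automaton (ACA) $\mathcal A=(Q,q_0,\delta,F)$ over a finite set $\mathit{AP}$ of variables has a finite state set $Q$, an initial state $q_0\in Q$, rejecting states $F\subseteq Q$ and $\delta:Q\times 2^{\mathit{AP}}\to 2^{2^Q}$, where $\delta(q,a)$ is a positive Boolean formula in disjunctive normal form given as the set of its conjunctions. A letter $a$ over other variables is read as $a\cap \mathit{AP}$. **Delay-dominance.** For infinite words $\sigma,\sigma'$, the delay-dominance game $(\mathcal A,\sigma,\sigma')$ is played by Spoiler and Duplicator in rounds $j=0,1,\dots$ on pairs $(p,q)$ of states, starting with $(q_0,q_0)$: Spoiler chooses $c\in\delta(p,\sigma_j)$, then Duplicator chooses $c'\in\delta(q,\sigma'_j)$, then Spoiler chooses $q'\in c'$, then Duplicator chooses $p'\in c$, and the next pair is $(p',q')$. A player who has to move and cannot loses. Duplicator wins an infinite play if for each round in which $q\in F$ there is the same or a later round in which $p\in F$. Duplicator wins the game if Duplicator has a winning strategy, and loses it otherwise. A strategy $s$ delay-dominates a strategy $t$ for the same process on $\gamma$ if Duplicator wins $(\mathcal A,\mathrm{comp}(t,\gamma),\mathrm{comp}(s,\gamma))$;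 $s$ is delay-dominant for $\mathcal A$ if it delay-dominates every strategy $t$ for this process on every input sequence $\gamma\in(2^I)^\omega$. **Bad prefixes.** $\mathcal A$ ensures bad prefixes for delay-dominance if for every nonempty set $S$ of system processes, every strategy $s$ for their composition and every $\gamma\in(2^{I_S})^\omega$ on which $s$ does not delay-dominate some strategy $t$, there is a finite (possibly empty) prefix $\eta$ of $\mathrm{comp}(s,\gamma)$ such that for every infinite extension $\sigma\in(2^{I_S\cup O_S})^\omega$ of $\eta$ there is $\sigma'\in(2^{I_S\cup O_S})^\omega$ with $\sigma'_n\cap I_S=\sigma_n\cap I_S$ for all $n$ such that Duplicator loses the game $(\mathcal A,\sigma',\sigma)$. **Theorem.** Let $\mathcal A$ be an ACA over $\mathit{AP}$ that ensures bad prefixes for delay-dominance. Let $p_1\ne p_2$ be system processes with $\mathit{AP}\subseteq V_1$ and $\mathit{AP}\subseteq V_2$. If $s_1$ and $s_2$ are delay-dominant strategies for $\mathcal A$ and $p_1$, $p_2$, respectively, then $s_1\,||\,s_2$ is delay-dominant for $\mathcal A$ and $p_1\,||\,p_2$. -/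

import Mathlib

namespace DelayDom

/-! ### Two-player games -/

/-- A two-player game. `V0` is the set of positions of Player 0, the remaining positions belong to
Player 1; `win` is the set of infinite plays won by Player 0. -/
structure Game (V : Type*) where
  init : V
  V0 : Set V
  edge : V → V → Prop
  win : Set (ℕ → V)

/-- The prefix `ρ₀ … ρₙ` of length `n + 1` of an infinite sequence. -/
def pref {V : Type*} (ρ : ℕ → V) (n : ℕ) : List V :=
  (List.range (n + 1)).map ρ

namespace Game

variable {V : Type*}

/-- The step from `ρ n` to `ρ (n + 1)` follows an edge, and it is the one prescribed by the strategy
`τ` of Player 0 (a function of the history including the current position) if Player 0 moves. -/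
def StepOk (G : Game V) (τ : List V → V) (ρ : ℕ → V) (n : ℕ) : Prop :=
  G.edge (ρ n) (ρ (n + 1)) ∧ (ρ n ∈ G.V0 → ρ (n + 1) = τ (pref ρ n))

/-- `τ` is a winning strategy for Player 0: on every history that starts in the initial position, is
consistent with `τ` and ends in a position of Player 0, the move of `τ` follows an edge, and every
infinite initial play consistent with `τ` is won by Player 0. So a player that has to move
and cannot loses; if every position has a successor, nobody is ever in this situation. -/
def IsWinning (G : Game V) (τ : List V → V) : Prop :=
  (∀ (ρ : ℕ → V) (n : ℕ), ρ 0 = G.init → (∀ k < n, G.StepOk τ ρ k) → ρ n ∈ G.V0 →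
    G.edge (ρ n) (τ (pref ρ n))) ∧
  (∀ ρ : ℕ → V, ρ 0 = G.init → (∀ k, G.StepOk τ ρ k) → ρ ∈ G.win)

/-- Player 0 wins the game. -/
def Player0Wins (G : Game V) : Prop :=
  ∃ τ : List V → V, G.IsWinning τ

end Game

/-! ### Alternating co-Büchi automata -/

/-- An alternating co-Büchi automaton over the alphabet `2 ^ props`. The value `δ q a` is a positive
Boolean formula in disjunctive normal form, as the set of its conjunctions. A letter `a` of a word
over a larger set of variables is read as `a ∩ props`. -/
structure ACA (Var Q : Type*) where
  props : Finset Var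
  init : Q
  δ : Q → Finset Var → Finset (Finset Q)
  rej : Set Q

/-- The conjunctions available in state `q` when reading the letter `a`. -/
def ACA.step {Var Q : Type*} [DecidableEq Var] (A : ACA Var Q) (q : Q) (a : Finset Var) :
    Finset (Finset Q) :=
  A.δ q (a ∩ A.props)

/-! ### The delay-dominance game -/

/-- Positions of the delay-dominance game: `p` is the alternative state, `q` the dominant state and
`j` the number of the round. Spoiler moves in `spExists` and `spForall`, Duplicator in the other
two kinds of positions. -/
inductive Pos (Q : Type*)
  | spExists (p q : Q) (j : ℕ)
  | dupExists (p q : Q) (c : Finset Q) (j : ℕ)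
  | spForall (p q : Q) (c c' : Finset Q) (j : ℕ)
  | dupForall (p q : Q) (c : Finset Q) (q' : Q) (j : ℕ)

namespace Pos

variable {Q : Type*}

/-- The alternative state of a position. -/
def alt : Pos Q → Q
  | spExists p _ _ => p
  | dupExists p _ _ _ => p
  | spForall p _ _ _ _ => p
  | dupForall p _ _ _ _ => p

/-- The dominant state of a position. -/
def dom : Pos Q → Q
  | spExists _ q _ => q
  | dupExists _ q _ _ => q
  | spForall _ q _ _ _ => q
  | dupForall _ q _ _ _ => q

/-- The positions of Duplicator. -/
def IsDup : Pos Q → Prop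
  | spExists _ _ _ => False
  | dupExists _ _ _ _ => True
  | spForall _ _ _ _ _ => False
  | dupForall _ _ _ _ _ => True

end Pos

section

variable {Var Q : Type*} [DecidableEq Var]

/-- The edges of the delay-dominance game for the alternative word `σ` and the dominant
word `σ'`. -/
inductive DDEdge (A : ACA Var Q) (σ σ' : ℕ → Finset Var) : Pos Q → Pos Q → Prop
  | chooseAltSet {p q : Q} {j : ℕ} {c : Finset Q} (h : c ∈ A.step p (σ j)) :
      DDEdge A σ σ' (.spExists p q j) (.dupExists p q c j)
  | chooseDomSet {p q : Q} {j : ℕ} {c c' : Finset Q} (h : c' ∈ A.step q (σ' j)) :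
      DDEdge A σ σ' (.dupExists p q c j) (.spForall p q c c' j)
  | chooseDomState {p q q' : Q} {j : ℕ} {c c' : Finset Q} (h : q' ∈ c') :
      DDEdge A σ σ' (.spForall p q c c' j) (.dupForall p q c q' j)
  | chooseAltState {p q p' q' : Q} {j : ℕ} {c : Finset Q} (h : p' ∈ c) :
      DDEdge A σ σ' (.dupForall p q c q' j) (.spExists p' q' (j + 1))

/-- The delay-dominance game `(A, σ, σ')`; Duplicator is Player 0. -/
def ddGame (A : ACA Var Q) (σ σ' : ℕ → Finset Var) : Game (Pos Q) where
  init := .spExists A.init A.init 0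
  V0 := {v | v.IsDup}
  edge := DDEdge A σ σ'
  win := {ρ | ∀ j, (ρ j).dom ∈ A.rej → ∃ j', j ≤ j' ∧ (ρ j').alt ∈ A.rej}

/-- Duplicator wins the delay-dominance game `(A, σ, σ')`. -/
def DuplicatorWins (A : ACA Var Q) (σ σ' : ℕ → Finset Var) : Prop :=
  (ddGame A σ σ').Player0Wins

end

/-! ### Process strategies -/

/-- `σ` is an infinite word over the alphabet `2 ^ X`. -/
def IsWordOver {Var : Type*} (X : Finset Var) (σ : ℕ → Finset Var) : Prop :=
  ∀ n, σ n ⊆ X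

/-- A process strategy with inputs `I` and outputs `O`: a finite Moore machine. Only the values of
`trans` on subsets of `I` matter. -/
structure Strategy {Var : Type*} (I O : Finset Var) where
  State : Type
  finite : Finite State
  init : State
  trans : State → Finset Var → State
  out : State → Finset Var
  out_subset : ∀ t, out t ⊆ O

namespace Strategy

variable {Var : Type*} {I O : Finset Var}

/-- The state reached after reading the first `n` letters of `γ`. -/
def stateAt (s : Strategy I O) (γ : ℕ → Finset Var) : ℕ → s.State
  | 0 => s.init
  | n + 1 => s.trans (s.stateAt γ n) (γ n)

variable [DecidableEq Var]

/-- The computation of `s` on the input sequence `γ`. -/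
def comp (s : Strategy I O) (γ : ℕ → Finset Var) : ℕ → Finset Var :=
  fun n => γ n ∪ s.out (s.stateAt γ n)

/-- Parallel composition of Moore machines. -/
def par {I₁ O₁ I₂ O₂ : Finset Var} (s₁ : Strategy I₁ O₁) (s₂ : Strategy I₂ O₂) :
    Strategy ((I₁ ∪ I₂) \ (O₁ ∪ O₂)) (O₁ ∪ O₂) where
  State := s₁.State × s₂.State
  finite := by
    have := s₁.finite
    have := s₂.finite
    infer_instance
  init := (s₁.init, s₂.init)
  trans := fun t ι =>
    (s₁.trans t.1 ((ι ∪ s₂.out t.2) ∩ I₁), s₂.trans t.2 ((ι ∪ s₁.out t.1) ∩ I₂))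
  out := fun t => s₁.out t.1 ∪ s₂.out t.2
  out_subset := fun t => Finset.union_subset_union (s₁.out_subset t.1) (s₂.out_subset t.2)

end Strategy

section

variable {Var Q : Type*} [DecidableEq Var] {I O : Finset Var}

/-- `s` delay-dominates `t` on the input sequence `γ`. -/
def DominatesOn (A : ACA Var Q) (s t : Strategy I O) (γ : ℕ → Finset Var) : Prop :=
  DuplicatorWins A (t.comp γ) (s.comp γ)

/-- `s` delay-dominates `t`. -/
def Dominates (A : ACA Var Q) (s t : Strategy I O) : Prop :=
  ∀ γ : ℕ → Finset Var, IsWordOver I γ → DominatesOn A s t γ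

/-- `s` is delay-dominant. -/
def IsDelayDominant (A : ACA Var Q) (s : Strategy I O) : Prop :=
  ∀ t : Strategy I O, Dominates A s t

end

/-! ### Architectures and bad prefixes -/

/-- The system processes of an architecture with their input and output variables. -/
structure Architecture (Proc Var : Type*) where
  inp : Proc → Finset Var
  out : Proc → Finset Var
  inp_disjoint_out : ∀ i, Disjoint (inp i) (out i)
  out_disjoint_out : ∀ i j, i ≠ j → Disjoint (out i) (out j)

namespace Architecture

variable {Proc Var Q : Type*} [DecidableEq Var]

/-- The variables of a system process. -/
def vars (arch : Architecture Proc Var) (i : Proc) : Finset Var :=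
  arch.inp i ∪ arch.out i

/-- The outputs of the parallel composition of the processes in `S`. -/
def outputs (arch : Architecture Proc Var) (S : Finset Proc) : Finset Var :=
  S.biUnion arch.out

/-- The inputs of the parallel composition of the processes in `S`. -/
def inputs (arch : Architecture Proc Var) (S : Finset Proc) : Finset Var :=
  S.biUnion arch.inp \ S.biUnion arch.out

/-- `A` ensures bad prefixes for delay-dominance: for every system process and every parallel
composition of system processes (the composition of a nonempty set `S` of processes; a single process
is the case of a one-element set), every strategy `s` for it and every input sequence `γ` on
which `s` fails to delay-dominate some alternative, the computation of `s` on `γ` has a finite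
prefix, of length `k`, no infinite extension of which delay-dominates all words with the same
inputs. -/
def EnsuresBadPrefixes (arch : Architecture Proc Var) (A : ACA Var Q) : Prop :=
  ∀ S : Finset Proc, S.Nonempty →
    ∀ (s : Strategy (arch.inputs S) (arch.outputs S)) (γ : ℕ → Finset Var),
      IsWordOver (arch.inputs S) γ →
      (∃ t : Strategy (arch.inputs S) (arch.outputs S), ¬ DominatesOn A s t γ) →
      ∃ k : ℕ, ∀ σ : ℕ → Finset Var, IsWordOver (arch.inputs S ∪ arch.outputs S) σ →
        (∀ n < k, σ n = s.comp γ n) →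
        ∃ σ' : ℕ → Finset Var, IsWordOver (arch.inputs S ∪ arch.outputs S) σ' ∧
          (∀ n, σ n ∩ arch.inputs S = σ' n ∩ arch.inputs S) ∧
          ¬ DuplicatorWins A σ' σ

end Architecture

end DelayDom

/-! Write "`x` beats `y`" for Spoiler winning with alternative word `x` and dominant word `y`. A
flag recording an unanswered rejecting dominant state turns Spoiler's goal into "the flag is unset
only finitely often", a fixed point `μ Z. ν Y` over rounds. Its ranks and escape measures give
determinacy (`duplicatorWins_iff_not_beats`), and playing three games at once gives transitivity
(`Beats.trans_or`).

A delay-dominant strategy is compared only with finite-state strategies, but a word beating its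
computation can be folded into a lasso that still beats it (`Forced.exists_lasso`). Hence its
computations are beaten by no word with the same inputs (`IsDelayDominant.not_beats_comp`), and
replacing the outputs in any word by the strategy's reaction never makes the word worse. Alternating
reactions of `s₁` and `s₂` therefore produce words that the original does not beat, and that agree
with the computation of `s₁.par s₂` on ever longer prefixes.

Suppose that computation is beaten, with a bad prefix. Any word `z` with the same inputs can be
iterated until it has this prefix; the result is beaten by some `z'`, and by transitivity `z'` beats
`z`. So there is an infinite chain of words, each beating its predecessor. Playing all these games
simultaneously gives, for each word of the chain, a visit to a rejecting state after which its
successor has none, hence an infinite descent of times (`not_forall_beats_succ`). This needs a first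
word on which the automaton does not get stuck; the stuck case depends on a finite prefix only and
is settled by `not_beats_of_diesWithin`. -/

namespace DelayDom

/-! ### Two-level fixed points over infinite words -/

section Forced

variable {P : Type*}

/-- Monotonicity of a family of binary set operators. -/
def MonoOps (L : ℕ → Set P → Set P → Set P) : Prop :=
  ∀ j Y Y' Z Z', Y ⊆ Y' → Z ⊆ Z' → L j Y Z ⊆ L j Y' Z'

/-- The fixed point `μ Z. ν Y. L Y Z` of a time-dependent family of operators. -/
inductive Forced (L : ℕ → Set P → Set P → Set P) : ℕ → P → Prop
  | intro (Y Z : ℕ → Set P) (hZ : ∀ j, ∀ v ∈ Z j, Forced L j v)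
      (hY : ∀ j, ∀ v ∈ Y j, v ∈ L j (Y (j + 1)) (Z (j + 1))) (j : ℕ) (v : P) (h : v ∈ Y j) :
      Forced L j v

/-- `Forced` as a family of sets. -/
def forcedSet (L : ℕ → Set P → Set P → Set P) (j : ℕ) : Set P :=
  {v | Forced L j v}

variable {L : ℕ → Set P → Set P → Set P}

theorem Forced.unfold (hL : MonoOps L) {j : ℕ} {v : P} (h : Forced L j v) :
    v ∈ L j (forcedSet L (j + 1)) (forcedSet L (j + 1)) := by
  cases h with
  | intro Y Z hZ hY _ _ h =>
    exact hL _ _ _ _ _ (fun u hu => Forced.intro Y Z hZ hY _ _ hu) (fun u hu => hZ _ u hu) (hY j v h)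

theorem Forced.coind (Y : ℕ → Set P)
    (hY : ∀ j, ∀ v ∈ Y j, v ∈ L j (Y (j + 1)) (forcedSet L (j + 1))) {j : ℕ} {v : P}
    (h : v ∈ Y j) : Forced L j v :=
  Forced.intro Y (forcedSet L) (fun _ _ h => h) hY j v h

theorem Forced.fold (hL : MonoOps L) {j : ℕ} {v : P}
    (h : v ∈ L j (forcedSet L (j + 1)) (forcedSet L (j + 1))) : Forced L j v :=
  Forced.coind (fun j => L j (forcedSet L (j + 1)) (forcedSet L (j + 1)))
    (fun _ _ hu => hL _ _ _ _ _ (fun _ hw => Forced.unfold hL hw) (fun _ hw => hw) hu) h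

/-- The stages of the outer fixed point of `Forced`. -/
inductive ForcedStage {P : Type u} (L : ℕ → Set P → Set P → Set P) :
    Ordinal.{u} → ℕ → P → Prop
  | intro (α : Ordinal.{u}) (Y Z : ℕ → Set P) (β : ℕ → P → Ordinal.{u})
      (hβ : ∀ j, ∀ v ∈ Z j, β j v < α) (hZ : ∀ j, ∀ v ∈ Z j, ForcedStage L (β j v) j v)
      (hY : ∀ j, ∀ v ∈ Y j, v ∈ L j (Y (j + 1)) (Z (j + 1))) (j : ℕ) (v : P) (h : v ∈ Y j) :
      ForcedStage L α j v

theorem ForcedStage.forced {P : Type u} {L : ℕ → Set P → Set P → Set P} {α : Ordinal.{u}} {j : ℕ}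
    {v : P} (h : ForcedStage L α j v) : Forced L j v := by
  induction h with
  | intro α Y Z β hβ hZ hY j v h ih => exact Forced.intro Y Z ih hY j v h

theorem Forced.exists_stage {P : Type u} {L : ℕ → Set P → Set P → Set P} {j : ℕ} {v : P}
    (h : Forced L j v) : ∃ α, ForcedStage L α j v := by
  classical
  induction h with
  | intro Y Z hZ hY j v h ih =>
    choose! β hβ using ih
    refine ⟨⨆ x : ℕ × P, Order.succ (β x.1 x.2),
      ForcedStage.intro _ Y Z β (fun j v _ => ?_) hβ hY j v h⟩
    exact (Order.lt_succ _).trans_le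
      (Ordinal.le_iSup (fun x : ℕ × P => Order.succ (β x.1 x.2)) (j, v))

/-- Positions in `Forced` carry an ordinal that can be kept from increasing, and made to decrease
whenever the outer fixed point is unfolded. -/
theorem Forced.exists_rank {P : Type u} {L : ℕ → Set P → Set P → Set P} (hL : MonoOps L) :
    ∃ ρ : ℕ → P → Ordinal.{u}, ∀ j v, Forced L j v →
      v ∈ L j {u | Forced L (j + 1) u ∧ ρ (j + 1) u ≤ ρ j v}
        {u | Forced L (j + 1) u ∧ ρ (j + 1) u < ρ j v} := by
  refine ⟨fun j v => sInf {α | ForcedStage L α j v}, fun j v h => ?_⟩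
  have hmem : ForcedStage L (sInf {α | ForcedStage L α j v}) j v :=
    csInf_mem (s := {α | ForcedStage L α j v}) h.exists_stage
  beta_reduce
  generalize sInf {α | ForcedStage L α j v} = α at hmem ⊢
  cases hmem with
  | intro _ Y Z β hβ hZ hY _ _ h =>
    refine hL _ _ _ _ _ (fun u hu => ?_) (fun u hu => ?_) (hY j v h)
    · have := ForcedStage.intro _ Y Z β hβ hZ hY _ _ hu
      exact ⟨this.forced, csInf_le' (s := {α | ForcedStage L α (j + 1) u}) this⟩
    · have := hZ _ u hu
      exact ⟨this.forced, (csInf_le' (s := {α | ForcedStage L α (j + 1) u}) this).trans_lt (hβ _ u hu)⟩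

/-- The stages of the complement of the inner fixed point at the value `Forced`. -/
def escapeStage (L : ℕ → Set P → Set P → Set P) : ℕ → ℕ → Set P
  | 0, _ => ∅
  | n + 1, j => (L j (escapeStage L n (j + 1))ᶜ (forcedSet L (j + 1)))ᶜ

theorem escapeStage_subset_succ (hL : MonoOps L) (n j : ℕ) :
    escapeStage L n j ⊆ escapeStage L (n + 1) j := by
  induction n generalizing j with
  | zero => exact Set.empty_subset _
  | succ n ih =>
    exact Set.compl_subset_compl.2
      (hL _ _ _ _ _ (Set.compl_subset_compl.2 (ih (j + 1))) subset_rfl)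

theorem escapeStage_mono (hL : MonoOps L) {m n : ℕ} (h : m ≤ n) (j : ℕ) :
    escapeStage L m j ⊆ escapeStage L n j :=
  monotone_nat_of_le_succ (f := fun n => escapeStage L n j)
    (fun n => escapeStage_subset_succ hL n j) h

theorem not_forced_of_mem_escapeStage (hL : MonoOps L) {n j : ℕ} {v : P}
    (h : v ∈ escapeStage L n j) : ¬ Forced L j v := by
  induction n generalizing j v with
  | zero => exact absurd h (Set.notMem_empty v)
  | succ n ih =>
    intro hv
    exact h (hL _ _ _ _ _ (fun u hu hu' => ih hu' hu) subset_rfl (hv.unfold hL))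

/-- There are finitely many positions, so at each time one stage contains all the others. The
complement of the union of the stages is then closed under the inner operator, and `ω` stages
suffice although time is unbounded. -/
theorem exists_mem_escapeStage [Finite P] (hL : MonoOps L) {j : ℕ} {v : P}
    (h : ¬ Forced L j v) : ∃ n, v ∈ escapeStage L n j := by
  classical
  by_contra hv
  refine h (Forced.coind (fun j => {v | ¬ ∃ n, v ∈ escapeStage L n j}) (fun i u hu => ?_) hv)
  have : ∃ N, ∀ w, (∃ n, w ∈ escapeStage L n (i + 1)) → w ∈ escapeStage L N (i + 1) := by
    have := Fintype.ofFinite P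
    choose! f hf using fun (w : P) (hw : ∃ n, w ∈ escapeStage L n (i + 1)) => hw
    exact ⟨Finset.univ.sup f, fun w hw =>
      escapeStage_mono hL (Finset.le_sup (Finset.mem_univ w)) _ (hf w hw)⟩
  obtain ⟨N, hN⟩ := this
  have h1 : u ∉ escapeStage L (N + 1) i := fun h => hu ⟨_, h⟩
  have h2 := not_not.1 h1
  exact hL i (escapeStage L N (i + 1))ᶜ _ _ _ (fun w hw hw' => hw (hN w hw')) subset_rfl h2

/-- Positions outside `Forced` carry a number that can be made to decrease until the outer fixed
point is unfolded. -/
theorem exists_escape_measure [Finite P] (hL : MonoOps L) :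
    ∃ m : ℕ → P → ℕ, ∀ j v, ¬ Forced L j v →
      v ∉ L j {u | ¬ (¬ Forced L (j + 1) u ∧ m (j + 1) u < m j v)} (forcedSet L (j + 1)) := by
  refine ⟨fun j v => sInf {n | v ∈ escapeStage L n j}, fun j v h => ?_⟩
  have hmem : v ∈ escapeStage L (sInf {n | v ∈ escapeStage L n j}) j :=
    Nat.sInf_mem (s := {n | v ∈ escapeStage L n j}) (exists_mem_escapeStage hL h)
  beta_reduce
  generalize sInf {n | v ∈ escapeStage L n j} = n at hmem ⊢
  cases n with
  | zero => exact absurd hmem (Set.notMem_empty v)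
  | succ n =>
    refine fun h' => hmem (hL _ _ _ _ _ ?_ subset_rfl h')
    refine fun u hu hu' => hu ⟨not_forced_of_mem_escapeStage hL hu',
      Nat.lt_succ_of_le (Nat.sInf_le (s := {n | u ∈ escapeStage L n (j + 1)}) hu')⟩

/-! ### Segments and blocks -/

/-- The operator of the segment of length `r` that starts at time `j`: the first argument is
the target if the outer fixed point is not unfolded in the segment, the second one otherwise. -/
def seg (L : ℕ → Set P → Set P → Set P) : ℕ → ℕ → Set P → Set P → Set P
  | _, 0, Y, _ => Y
  | j, r + 1, Y, Z => L j (seg L (j + 1) r Y Z) (seg L (j + 1) r Z Z)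

theorem seg_mono (hL : MonoOps L) {j r : ℕ} {Y Y' Z Z' : Set P} (hY : Y ⊆ Y') (hZ : Z ⊆ Z') :
    seg L j r Y Z ⊆ seg L j r Y' Z' := by
  induction r generalizing j Y Y' Z Z' with
  | zero => exact hY
  | succ r ih => exact hL _ _ _ _ _ (ih hY hZ) (ih hZ hZ)

theorem seg_congr {L' : ℕ → Set P → Set P → Set P} {j j' r : ℕ}
    (h : ∀ i < r, L (j + i) = L' (j' + i)) : seg L j r = seg L' j' r := by
  induction r generalizing j j' with
  | zero => rfl
  | succ r ih =>
    have h0 : L j = L' j' := h 0 (Nat.succ_pos r)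
    have h1 : seg L (j + 1) r = seg L' (j' + 1) r := ih fun i hi => by
      have := h (i + 1) (Nat.succ_lt_succ hi)
      rwa [Nat.add_comm i 1, ← Nat.add_assoc, ← Nat.add_assoc] at this
    funext Y Z
    simp only [seg, h0, h1]

theorem seg_forcedSet_subset (hL : MonoOps L) (j r : ℕ) :
    seg L j r (forcedSet L (j + r)) (forcedSet L (j + r)) ⊆ forcedSet L j := by
  induction r generalizing j with
  | zero => exact subset_rfl
  | succ r ih =>
    have h := ih (j + 1)
    rw [Nat.add_assoc, Nat.add_comm 1 r] at h
    exact fun v hv => Forced.fold hL (hL _ _ _ _ _ h h hv)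

/-- The operators of the blocks between consecutive cut points. -/
def blockOps (L : ℕ → Set P → Set P → Set P) (cut : ℕ → ℕ) (n : ℕ) : Set P → Set P → Set P :=
  seg L (cut n) (cut (n + 1) - cut n)

theorem MonoOps.blockOps (hL : MonoOps L) (cut : ℕ → ℕ) : MonoOps (blockOps L cut) :=
  fun _ _ _ _ _ hY hZ => seg_mono hL hY hZ

/-- The outer fixed point may be unfolded in the middle of a block, so the induction has to cover
every starting time inside a block, not only cut points. -/
theorem Forced.mem_seg_block (hL : MonoOps L) {cut : ℕ → ℕ} (hcut : StrictMono cut) {j : ℕ}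
    {v : P} (h : Forced L j v) (n : ℕ) (h1 : cut n ≤ j) (r : ℕ) (h2 : j + r = cut (n + 1)) :
    v ∈ seg L j r (forcedSet (DelayDom.blockOps L cut) (n + 1))
      (forcedSet (DelayDom.blockOps L cut) (n + 1)) := by
  induction h generalizing n r with
  | intro Y Z hZ hY j v h ih =>
    have key : ∀ n r i, cut n ≤ i → i + r = cut (n + 1) →
        Y i ⊆ seg L i r (Y (cut (n + 1))) (forcedSet (DelayDom.blockOps L cut) (n + 1)) := by
      intro n r
      induction r with
      | zero =>
        intro i _ hi
        rw [← hi]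
        exact subset_rfl
      | succ r ihr =>
        intro i hi1 hi2 u hu
        exact hL _ _ _ _ _ (ihr (i + 1) (by omega) (by omega))
          (fun w hw => ih (i + 1) w hw n (by omega) r (by omega)) (hY i u hu)
    have hsub : ∀ n, Y (cut n) ⊆ forcedSet (DelayDom.blockOps L cut) n := fun n u hu =>
      Forced.coind (fun n => Y (cut n)) (fun n w hw =>
        key n (cut (n + 1) - cut n) (cut n) le_rfl
          (Nat.add_sub_cancel' (hcut (Nat.lt_succ_self n)).le) hw) hu
    exact seg_mono hL (hsub (n + 1)) subset_rfl (key n r j h1 h2 h)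

theorem Forced.to_block (hL : MonoOps L) {cut : ℕ → ℕ} (hcut : StrictMono cut) {n : ℕ} {v : P}
    (h : Forced L (cut n) v) : Forced (DelayDom.blockOps L cut) n v :=
  Forced.fold (hL.blockOps cut) (h.mem_seg_block hL hcut n le_rfl _
    (Nat.add_sub_cancel' (hcut (Nat.lt_succ_self n)).le))

theorem Forced.of_block (hL : MonoOps L) {cut : ℕ → ℕ} (hcut : StrictMono cut) {n : ℕ} {v : P}
    (h : Forced (DelayDom.blockOps L cut) n v) : Forced L (cut n) v := by
  induction h with
  | intro Y Z hZ hY n v h ih =>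
    have hstart : ∀ n, ∀ u ∈ Y n, ∃ r, cut n + (r + 1) = cut (n + 1) ∧
        u ∈ seg L (cut n) (r + 1) (Y (n + 1)) (forcedSet L (cut (n + 1))) := by
      intro n u hu
      have hlt : cut n < cut (n + 1) := hcut (Nat.lt_succ_self n)
      refine ⟨cut (n + 1) - cut n - 1, by omega, ?_⟩
      have h1 : cut (n + 1) - cut n - 1 + 1 = cut (n + 1) - cut n := by omega
      rw [h1]
      exact seg_mono hL subset_rfl (fun w hw => ih (n + 1) w hw) (hY n u hu)
    -- The coinductive set consists of positions inside a block. The remaining length `r + 1` is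
    -- positive, so there is always a step of `L` to expose; when a block ends, the next one is
    -- opened at once.
    refine Forced.coind (fun j => {u | ∃ n r, j + (r + 1) = cut (n + 1) ∧
      u ∈ seg L j (r + 1) (Y (n + 1)) (forcedSet L (cut (n + 1)))}) ?_ ?_
    · rintro j u ⟨n, r, hr, hu⟩
      refine hL _ _ _ _ _ ?_ ?_ hu
      · intro w hw
        cases r with
        | zero =>
          obtain ⟨r', hr', hw'⟩ := hstart (n + 1) w hw
          have hj : j + 1 = cut (n + 1) := hr
          rw [← hj] at hr' hw'
          exact ⟨n + 1, r', hr', hw'⟩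
        | succ r => exact ⟨n, r, by omega, hw⟩
      · have := seg_forcedSet_subset hL (j + 1) r
        rwa [show j + 1 + r = cut (n + 1) by omega] at this
    · obtain ⟨r, hr⟩ := hstart n v h
      exact ⟨n, r, hr⟩

/-! ### Replacing a word by an ultimately periodic one -/

/-- A Ramsey argument by ultrafilter limits: each `color i` has a limit colour `e i`, and `e` has a
limit `e₀`. From an index with limit `e₀` there is always a later such index joined to it by colour
`e₀`. -/
theorem exists_consecutive_homogeneous {κ : Type*} [Finite κ] (color : ℕ → ℕ → κ) :
    ∃ c : ℕ → ℕ, StrictMono c ∧ 0 < c 0 ∧ ∀ n, color (c n) (c (n + 1)) = color (c 0) (c 1) := by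
  have huf : ∀ f : ℕ → κ, ∃ e, ∀ᶠ k in (Filter.hyperfilter ℕ : Filter ℕ), f k = e := by
    intro f
    obtain ⟨e, he⟩ := Ultrafilter.eq_pure_of_finite ((Filter.hyperfilter ℕ).map f)
    refine ⟨e, ?_⟩
    have : {e} ∈ (Filter.hyperfilter ℕ).map f := by
      rw [he]
      exact Set.mem_singleton e
    exact this
  have hgt : ∀ m, ∀ᶠ k in (Filter.hyperfilter ℕ : Filter ℕ), m < k := fun m =>
    Nat.hyperfilter_le_atTop (Filter.eventually_gt_atTop m)
  choose e he using fun i => huf (color i)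
  obtain ⟨e₀, he₀⟩ := huf e
  obtain ⟨a, ha0, ha⟩ := ((hgt 0).and he₀).exists
  have hnext : ∀ i : {i // e i = e₀}, ∃ k : {i // e i = e₀}, i.1 < k.1 ∧ color i.1 k.1 = e₀ := by
    rintro ⟨i, hi⟩
    obtain ⟨k, ⟨hk1, hk2⟩, hk3⟩ := (((hgt i).and he₀).and (he i)).exists
    exact ⟨⟨k, hk2⟩, hk1, hk3.trans hi⟩
  choose next hnext1 hnext2 using hnext
  let c : ℕ → {i // e i = e₀} := fun n => next^[n] ⟨a, ha⟩
  have hc : ∀ n, c (n + 1) = next (c n) := fun n => Function.iterate_succ_apply' next n _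
  have hcol : ∀ n, color (c n).1 (c (n + 1)).1 = e₀ := fun n => by rw [hc]; exact hnext2 _
  refine ⟨fun n => (c n).1, strictMono_nat_of_lt_succ fun n => ?_, ha0, fun n => ?_⟩
  · rw [hc]
    exact hnext1 _
  · rw [hcol, hcol 0]

/-- The index map of the lasso with stem `a` and period `d`. -/
def lasso (a d n : ℕ) : ℕ :=
  if n < a then n else a + (n - a) % d

theorem lasso_lt {a d : ℕ} (hd : 0 < d) (n : ℕ) : lasso a d n < a + d := by
  have := Nat.mod_lt (n - a) hd
  unfold lasso
  split_ifs <;> omega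

theorem lasso_of_lt {a d n : ℕ} (hn : n < a + d) : lasso a d n = n := by
  unfold lasso
  split_ifs with h
  · rfl
  · rw [Nat.mod_eq_of_lt (by omega)]
    omega

theorem lasso_period (a d n i : ℕ) : lasso a d (a + n * d + i) = lasso a d (a + i) := by
  unfold lasso
  rw [if_neg (by omega), if_neg (by omega), Nat.add_sub_cancel_left, Nat.add_assoc,
    Nat.add_sub_cancel_left, Nat.add_comm (n * d) i, Nat.add_mul_mod_self_right]

theorem lasso_succ {a d : ℕ} (hd : 0 < d) (n : ℕ) :
    lasso a d (n + 1) = if lasso a d n + 1 < a + d then lasso a d n + 1 else a := by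
  by_cases h : n < a + d
  · rw [lasso_of_lt h]
    split_ifs with h'
    · exact lasso_of_lt h'
    · have h1 : n + 1 = a + 1 * d + 0 := by omega
      rw [h1, lasso_period, Nat.add_zero, lasso_of_lt (by omega)]
  · obtain ⟨m, rfl⟩ : ∃ m, n = a + m := ⟨n - a, by omega⟩
    have hm : a + m = a + m / d * d + m % d := by
      rw [Nat.add_assoc, Nat.mul_comm, Nat.div_add_mod]
    have hlt := Nat.mod_lt m hd
    rw [hm, lasso_period, Nat.add_assoc, lasso_period, lasso_of_lt (n := a + m % d) (by omega)]
    split_ifs with h'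
    · exact lasso_of_lt h'
    · have h1 : a + (m % d + 1) = a + 1 * d + 0 := by omega
      rw [h1, lasso_period, Nat.add_zero, lasso_of_lt (by omega)]

theorem lasso_lasso_succ {a d : ℕ} (hd : 0 < d) (n : ℕ) :
    lasso a d (lasso a d n + 1) = lasso a d (n + 1) := by
  rw [lasso_succ hd n, lasso_succ hd, lasso_of_lt (lasso_lt hd n)]

/-- If a position is forced then it is also forced for some lasso of the word; the two ends
of the period may be chosen to agree in a given finite observation. -/
theorem Forced.exists_lasso [Finite P] (hL : MonoOps L) {T : Type*} [Finite T] (t : ℕ → T) {v : P}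
    (h : Forced L 0 v) :
    ∃ a d, 0 < d ∧ t (a + d) = t a ∧ Forced (fun n => L (lasso a d n)) 0 v := by
  -- An interval is coloured by its whole segment operator and the observation at its left end; both
  -- range over finite types.
  obtain ⟨c, hc, hc0, hcol⟩ := exists_consecutive_homogeneous
    (fun i j => (seg L i (j - i), t i))
  have hlt : c 0 < c 1 := hc Nat.zero_lt_one
  obtain ⟨d, hd⟩ : ∃ d, c 1 = c 0 + d := ⟨c 1 - c 0, by omega⟩
  have hd0 : 0 < d := by omega
  refine ⟨c 0, d, hd0, ?_, ?_⟩
  · rw [← hd]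
    exact congrArg Prod.snd (hcol 1)
  -- The extra cut at `0` makes the stem the first block; `0 < c 0` keeps the cuts strictly
  -- increasing.
  let cut : ℕ → ℕ := fun n => Nat.casesOn n 0 c
  let cut' : ℕ → ℕ := fun n => Nat.casesOn n 0 (fun n => c 0 + n * d)
  have hcut : StrictMono cut := strictMono_nat_of_lt_succ fun n => by
    cases n with
    | zero => exact hc0
    | succ n => exact hc (Nat.lt_succ_self n)
  have hcut' : StrictMono cut' := strictMono_nat_of_lt_succ fun n => by
    cases n with
    | zero => show 0 < c 0 + 0 * d; omega
    | succ n => show c 0 + n * d < c 0 + (n + 1) * d; rw [Nat.add_mul]; omega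
  have hL' : MonoOps (fun n => L (lasso (c 0) d n)) := fun j => hL _
  -- By homogeneity, all blocks after the stem have the operator of the first one, although their
  -- lengths may differ. Blockwise, the word and its lasso are therefore indistinguishable.
  have hops : blockOps L cut = blockOps (fun n => L (lasso (c 0) d n)) cut' := by
    funext n
    cases n with
    | zero =>
      have h0 : cut' (0 + 1) - cut' 0 = cut (0 + 1) - cut 0 := by
        show c 0 + 0 * d - 0 = c 0 - 0
        omega
      unfold blockOps
      rw [h0]
      refine seg_congr fun i hi => ?_
      have hi' : i < c 0 := hi
      show L (0 + i) = L (lasso (c 0) d (0 + i))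
      rw [lasso_of_lt (by omega)]
    | succ n =>
      have h0 : cut' (n + 2) - cut' (n + 1) = d := by
        show c 0 + (n + 1) * d - (c 0 + n * d) = d
        rw [Nat.add_mul]
        omega
      have h1 : blockOps L cut (n + 1) = seg L (c 0) d := by
        have := congrArg Prod.fst (hcol n)
        rw [show c 1 - c 0 = d by omega] at this
        exact this
      rw [h1]
      unfold blockOps
      rw [h0]
      refine seg_congr fun i hi => ?_
      show L (c 0 + i) = L (lasso (c 0) d (c 0 + n * d + i))
      rw [lasso_period, lasso_of_lt (by omega)]
  have h1 : Forced (blockOps L cut) 0 v := Forced.to_block hL hcut (n := 0) h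
  rw [hops] at h1
  exact Forced.of_block hL' hcut' h1

end Forced

/-! ### Rounds of the delay-dominance game -/

section Rounds

variable {Var Q : Type*}

/-- The update of the flag saying that a rejecting dominant state has not been answered by a
rejecting alternative state. -/
def ACA.pending (A : ACA Var Q) (p q : Q) (f : Prop) : Prop :=
  p ∉ A.rej ∧ (q ∈ A.rej ∨ f)

theorem ACA.pending_idem (A : ACA Var Q) (p q : Q) (f : Prop) :
    A.pending p q (A.pending p q f) = A.pending p q f := by
  unfold ACA.pending
  apply propext
  tauto

theorem ACA.pending_init (A : ACA Var Q) : A.pending A.init A.init False = False := by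
  unfold ACA.pending
  apply propext
  tauto

/-- A flag that is eventually always set stems from an unanswered rejecting state. -/
theorem exists_unanswered (A : ACA Var Q) {p q : ℕ → Q} {f : ℕ → Prop}
    (h0 : f 0 → q 0 ∈ A.rej ∧ p 0 ∉ A.rej)
    (hf : ∀ n, f (n + 1) = A.pending (p (n + 1)) (q (n + 1)) (f n))
    {T : ℕ} (hT : ∀ n, T ≤ n → f n) : ∃ i, q i ∈ A.rej ∧ ∀ n, i ≤ n → p n ∉ A.rej := by
  have key : ∀ T, f T → ∃ i, q i ∈ A.rej ∧ ∀ n, i ≤ n → n ≤ T → p n ∉ A.rej := by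
    intro T
    induction T with
    | zero =>
      intro h
      refine ⟨0, (h0 h).1, fun n _ hn => ?_⟩
      obtain rfl : n = 0 := by omega
      exact (h0 h).2
    | succ T ih =>
      intro h
      rw [hf] at h
      obtain ⟨h1, h2 | h2⟩ := h
      · refine ⟨T + 1, h2, fun n hn hn' => ?_⟩
        obtain rfl : n = T + 1 := by omega
        exact h1
      · obtain ⟨i, hi, hi'⟩ := ih h2
        refine ⟨i, hi, fun n hn hn' => ?_⟩
        by_cases h : n = T + 1
        · rw [h]
          exact h1
        · exact hi' n hn (by omega)
  obtain ⟨i, hi, hi'⟩ := key T (hT T le_rfl)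
  refine ⟨i, hi, fun n hn => ?_⟩
  by_cases h : n ≤ T
  · exact hi' n hn h
  · obtain ⟨m, rfl⟩ : ∃ m, n = m + 1 := ⟨n - 1, by omega⟩
    have := hT (m + 1) (by omega)
    rw [hf] at this
    exact this.1

/-- An unanswered rejecting state sets the flag forever. -/
theorem flag_of_unanswered (A : ACA Var Q) {p q : ℕ → Q} {f : ℕ → Prop}
    (h0 : q 0 ∈ A.rej → p 0 ∉ A.rej → f 0)
    (hf : ∀ n, f (n + 1) = A.pending (p (n + 1)) (q (n + 1)) (f n))
    {i : ℕ} (hi : q i ∈ A.rej) (hp : ∀ n, i ≤ n → p n ∉ A.rej) {n : ℕ} (hn : i ≤ n) : f n := by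
  induction n, hn using Nat.le_induction with
  | base =>
    cases i with
    | zero => exact h0 hi (hp 0 le_rfl)
    | succ i =>
      rw [hf]
      exact ⟨hp _ le_rfl, Or.inl hi⟩
  | succ n hn ih =>
    rw [hf]
    exact ⟨hp _ (by omega), Or.inr ih⟩

variable [DecidableEq Var]

/-- One round of the game with alternative word `x` and dominant word `y`, for Spoiler: reach the
first set if the flag is set, the second one otherwise. -/
def roundOps (A : ACA Var Q) (x y : ℕ → Finset Var) (j : ℕ) (Y Z : Set (Q × Q × Prop)) :
    Set (Q × Q × Prop) :=
  {v | ∃ c ∈ A.step v.1 (x j), ∀ c' ∈ A.step v.2.1 (y j), ∃ q' ∈ c', ∀ p' ∈ c,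
    (v.2.2 → (p', q', A.pending p' q' v.2.2) ∈ Y) ∧
    (¬ v.2.2 → (p', q', A.pending p' q' v.2.2) ∈ Z)}

theorem monoOps_roundOps (A : ACA Var Q) (x y : ℕ → Finset Var) : MonoOps (roundOps A x y) := by
  rintro j Y Y' Z Z' hY hZ v ⟨c, hc, h⟩
  refine ⟨c, hc, fun c' hc' => ?_⟩
  obtain ⟨q', hq', h'⟩ := h c' hc'
  exact ⟨q', hq', fun p' hp' => ⟨fun hv => hY ((h' p' hp').1 hv), fun hv => hZ ((h' p' hp').2 hv)⟩⟩

/-- The positions at time `j` from which Spoiler wins. -/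
def SpoilerForces (A : ACA Var Q) (x y : ℕ → Finset Var) : ℕ → Q × Q × Prop → Prop :=
  Forced (roundOps A x y)

/-- Spoiler wins the delay-dominance game with alternative word `x` and dominant word `y`. -/
def Beats (A : ACA Var Q) (x y : ℕ → Finset Var) : Prop :=
  SpoilerForces A x y 0 (A.init, A.init, False)

theorem Beats.congr {A : ACA Var Q} {x x' y y' : ℕ → Finset Var}
    (hx : ∀ n, x n ∩ A.props = x' n ∩ A.props) (hy : ∀ n, y n ∩ A.props = y' n ∩ A.props)
    (h : Beats A x y) : Beats A x' y' := by
  have : roundOps A x y = roundOps A x' y' := by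
    funext j Y Z
    simp only [roundOps, ACA.step, hx, hy]
  unfold Beats SpoilerForces at *
  rwa [← this]

theorem SpoilerForces.exists_rank {Q : Type u} (A : ACA Var Q) (x y : ℕ → Finset Var) :
    ∃ ρ : ℕ → Q × Q × Prop → Ordinal.{u}, ∀ j p q f, SpoilerForces A x y j (p, q, f) →
      ∃ c ∈ A.step p (x j), ∀ c' ∈ A.step q (y j), ∃ q' ∈ c', ∀ p' ∈ c,
        SpoilerForces A x y (j + 1) (p', q', A.pending p' q' f) ∧
        ρ (j + 1) (p', q', A.pending p' q' f) ≤ ρ j (p, q, f) ∧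
        (¬ f → ρ (j + 1) (p', q', A.pending p' q' f) < ρ j (p, q, f)) := by
  obtain ⟨ρ, hρ⟩ := Forced.exists_rank (monoOps_roundOps A x y)
  refine ⟨ρ, fun j p q f h => ?_⟩
  obtain ⟨c, hc, hc'⟩ := hρ j (p, q, f) h
  refine ⟨c, hc, fun c' h' => ?_⟩
  obtain ⟨q', hq', hp'⟩ := hc' c' h'
  refine ⟨q', hq', fun p' h'' => ?_⟩
  obtain ⟨h1, h2⟩ := hp' p' h''
  by_cases hf : f
  · exact ⟨(h1 hf).1, (h1 hf).2, fun h => absurd hf h⟩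
  · exact ⟨(h2 hf).1, (h2 hf).2.le, fun _ => (h2 hf).2⟩

theorem SpoilerForces.exists_measure [Finite Q] (A : ACA Var Q) (x y : ℕ → Finset Var) :
    ∃ m : ℕ → Q × Q × Prop → ℕ, ∀ j p q f, ¬ SpoilerForces A x y j (p, q, f) →
      ∀ c ∈ A.step p (x j), ∃ c' ∈ A.step q (y j), ∀ q' ∈ c', ∃ p' ∈ c,
        ¬ SpoilerForces A x y (j + 1) (p', q', A.pending p' q' f) ∧
        (f → m (j + 1) (p', q', A.pending p' q' f) < m j (p, q, f)) := by
  obtain ⟨m, hm⟩ := exists_escape_measure (monoOps_roundOps A x y)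
  refine ⟨m, fun j p q f h c hc => ?_⟩
  by_contra! hcon
  refine hm j (p, q, f) h ⟨c, hc, fun c' hc' => ?_⟩
  obtain ⟨q', hq', h'⟩ := hcon c' hc'
  refine ⟨q', hq', fun p' hp' => ?_⟩
  have := h' p' hp'
  refine ⟨fun hf hcon' => ?_, fun hf => ?_⟩
  · obtain ⟨-, h2⟩ := this hcon'.1
    exact absurd hcon'.2 (not_lt.2 h2)
  · by_contra hcon'
    exact hf (this hcon').1

end Rounds

/-! ### Determinacy of the delay-dominance game -/

section Determinacy

variable {Var Q : Type*}

theorem pref_zero {V : Type*} (ρ : ℕ → V) : pref ρ 0 = [ρ 0] := rfl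

theorem pref_succ {V : Type*} (ρ : ℕ → V) (n : ℕ) : pref ρ (n + 1) = pref ρ n ++ [ρ (n + 1)] := by
  simp [pref, List.range_succ]

theorem getLastD_pref {V : Type*} (ρ : ℕ → V) (n : ℕ) (v : V) : (pref ρ n).getLastD v = ρ n := by
  cases n with
  | zero => rfl
  | succ n => rw [pref_succ]; simp

/-- The flag after a history. -/
def historyFlag (A : ACA Var Q) (l : List (Pos Q)) : Prop :=
  l.foldl (fun f v => A.pending v.alt v.dom f) False

theorem historyFlag_append (A : ACA Var Q) (l : List (Pos Q)) (v : Pos Q) :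
    historyFlag A (l ++ [v]) = A.pending v.alt v.dom (historyFlag A l) := by
  simp [historyFlag]

theorem historyFlag_pref_succ (A : ACA Var Q) (ρ : ℕ → Pos Q) (n : ℕ) :
    historyFlag A (pref ρ (n + 1)) =
      A.pending (ρ (n + 1)).alt (ρ (n + 1)).dom (historyFlag A (pref ρ n)) := by
  rw [pref_succ, historyFlag_append]

variable [DecidableEq Var]

/-- An invariant with a progress measure that Duplicator can maintain yields a win. -/
theorem duplicatorWins_of_invariant {A : ACA Var Q} {x y : ℕ → Finset Var}
    (Inv : Prop → Pos Q → Prop) (M : Pos Q → ℕ)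
    (h0 : Inv False (.spExists A.init A.init 0))
    (hdup : ∀ f v, Inv f v → v.IsDup → ∃ v', DDEdge A x y v v' ∧
      Inv (A.pending v'.alt v'.dom f) v' ∧ (f → A.pending v'.alt v'.dom f → M v' < M v))
    (hspoil : ∀ f v v', Inv f v → ¬ v.IsDup → DDEdge A x y v v' →
      Inv (A.pending v'.alt v'.dom f) v' ∧ (f → A.pending v'.alt v'.dom f → M v' < M v)) :
    DuplicatorWins A x y := by
  classical
  choose! move hmove using hdup
  let τ : List (Pos Q) → Pos Q := fun l =>
    move (historyFlag A l) (l.getLastD (.spExists A.init A.init 0))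
  have hτ : ∀ ρ n, τ (pref ρ n) = move (historyFlag A (pref ρ n)) (ρ n) := fun ρ n => by
    simp only [τ, getLastD_pref]
  have hzero : ∀ ρ : ℕ → Pos Q, ρ 0 = .spExists A.init A.init 0 →
      historyFlag A (pref ρ 0) = False := by
    intro ρ h
    rw [pref_zero, h]
    exact A.pending_init
  have hstep : ∀ ρ n, Inv (historyFlag A (pref ρ n)) (ρ n) → (ddGame A x y).StepOk τ ρ n →
      Inv (historyFlag A (pref ρ (n + 1))) (ρ (n + 1)) ∧
      (historyFlag A (pref ρ n) → historyFlag A (pref ρ (n + 1)) → M (ρ (n + 1)) < M (ρ n)) := by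
    intro ρ n hinv hok
    rw [historyFlag_pref_succ]
    by_cases hd : (ρ n).IsDup
    · have h1 : ρ (n + 1) = τ (pref ρ n) := hok.2 hd
      rw [hτ] at h1
      have h2 := hmove _ _ hinv hd
      rw [← h1] at h2
      exact h2.2
    · exact hspoil _ _ _ hinv hd hok.1
  have hinv : ∀ ρ n, ρ 0 = .spExists A.init A.init 0 →
      (∀ k < n, (ddGame A x y).StepOk τ ρ k) → Inv (historyFlag A (pref ρ n)) (ρ n) := by
    intro ρ n hρ
    induction n with
    | zero =>
      intro _
      rw [hzero ρ hρ, hρ]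
      exact h0
    | succ n ih =>
      intro h
      exact (hstep ρ n (ih fun k hk => h k (by omega)) (h n (by omega))).1
  refine ⟨τ, fun ρ n hρ hok hd => ?_, fun ρ hρ hok => ?_⟩
  · rw [hτ]
    exact (hmove _ _ (hinv ρ n hρ hok) hd).1
  · intro i hi
    by_contra! hcon
    have hflag : ∀ n, i ≤ n → historyFlag A (pref ρ n) := fun n hn =>
      flag_of_unanswered A (p := fun n => (ρ n).alt) (q := fun n => (ρ n).dom)
        (f := fun n => historyFlag A (pref ρ n))
        (fun hq hp => by
          simp only [hρ] at hq hp
          exact absurd hq hp)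
        (historyFlag_pref_succ A ρ) hi hcon hn
    -- An unanswered rejecting state keeps the flag set forever, so the measure would decrease
    -- forever.
    have hdec : ∀ k, M (ρ (i + k)) + k ≤ M (ρ i) := by
      intro k
      induction k with
      | zero => exact le_rfl
      | succ k ih =>
        have := (hstep ρ (i + k) (hinv ρ _ hρ fun j _ => hok j) (hok _)).2
          (hflag _ (by omega)) (hflag _ (by omega))
        rw [Nat.add_assoc] at this
        omega
    have := hdec (M (ρ i) + 1)
    omega

/-- An invariant with an ordinal progress measure that Spoiler can maintain excludes a win of
Duplicator. -/
theorem not_duplicatorWins_of_invariant {A : ACA Var Q} {x y : ℕ → Finset Var}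
    (Inv : Prop → Pos Q → Prop) (O : Prop → Pos Q → Ordinal) (M : Pos Q → ℕ)
    (h0 : Inv False (.spExists A.init A.init 0))
    (hspoil : ∀ f v, Inv f v → ¬ v.IsDup → ∃ v', DDEdge A x y v v' ∧
      Inv (A.pending v'.alt v'.dom f) v' ∧ O (A.pending v'.alt v'.dom f) v' ≤ O f v ∧
      (¬ f → O (A.pending v'.alt v'.dom f) v' < O f v ∨
        ¬ A.pending v'.alt v'.dom f ∧ M v' < M v))
    (hdup : ∀ f v v', Inv f v → v.IsDup → DDEdge A x y v v' →
      Inv (A.pending v'.alt v'.dom f) v' ∧ O (A.pending v'.alt v'.dom f) v' ≤ O f v ∧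
      (¬ f → O (A.pending v'.alt v'.dom f) v' < O f v ∨
        ¬ A.pending v'.alt v'.dom f ∧ M v' < M v)) :
    ¬ DuplicatorWins A x y := by
  classical
  rintro ⟨τ, hτ1, hτ2⟩
  choose! move hmove using hspoil
  let v₀ : Pos Q := .spExists A.init A.init 0
  let next : List (Pos Q) → Pos Q := fun l =>
    if (l.getLastD v₀).IsDup then τ l else move (historyFlag A l) (l.getLastD v₀)
  let hist : ℕ → List (Pos Q) := fun n => Nat.rec [v₀] (fun _ l => l ++ [next l]) n
  let ρ : ℕ → Pos Q := fun n => (hist n).getLastD v₀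
  have hρ0 : ρ 0 = v₀ := rfl
  have hρ_succ : ∀ n, ρ (n + 1) = next (hist n) := fun n => by
    show (hist n ++ [next (hist n)]).getLastD v₀ = _
    simp
  have hhist : ∀ n, pref ρ n = hist n := by
    intro n
    induction n with
    | zero => rfl
    | succ n ih => rw [pref_succ, ih, hρ_succ]
  have hnext : ∀ n, ρ (n + 1) =
      if (ρ n).IsDup then τ (pref ρ n) else move (historyFlag A (pref ρ n)) (ρ n) := fun n => by
    rw [hρ_succ, hhist]
  have hinv : ∀ n, (∀ k < n, (ddGame A x y).StepOk τ ρ k) ∧ Inv (historyFlag A (pref ρ n)) (ρ n) ∧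
      (∀ k < n, O (historyFlag A (pref ρ (k + 1))) (ρ (k + 1)) ≤
          O (historyFlag A (pref ρ k)) (ρ k) ∧
        (¬ historyFlag A (pref ρ k) → O (historyFlag A (pref ρ (k + 1))) (ρ (k + 1)) <
            O (historyFlag A (pref ρ k)) (ρ k) ∨
          ¬ historyFlag A (pref ρ (k + 1)) ∧ M (ρ (k + 1)) < M (ρ k))) := by
    intro n
    induction n with
    | zero =>
      refine ⟨fun k hk => absurd hk (Nat.not_lt_zero k), ?_, fun k hk => absurd hk (Nat.not_lt_zero k)⟩
      have : historyFlag A (pref ρ 0) = False := A.pending_init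
      rw [this]
      exact h0
    | succ n ih =>
      obtain ⟨ih1, ih2, ih3⟩ := ih
      have hn := hnext n
      have hall : (ddGame A x y).StepOk τ ρ n ∧
          Inv (historyFlag A (pref ρ (n + 1))) (ρ (n + 1)) ∧
          O (historyFlag A (pref ρ (n + 1))) (ρ (n + 1)) ≤ O (historyFlag A (pref ρ n)) (ρ n) ∧
          (¬ historyFlag A (pref ρ n) → O (historyFlag A (pref ρ (n + 1))) (ρ (n + 1)) <
            O (historyFlag A (pref ρ n)) (ρ n) ∨
          ¬ historyFlag A (pref ρ (n + 1)) ∧ M (ρ (n + 1)) < M (ρ n)) := by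
        rw [historyFlag_pref_succ]
        by_cases hd : (ρ n).IsDup
        · rw [if_pos hd] at hn
          have hedge := hτ1 ρ n hρ0 ih1 hd
          rw [← hn] at hedge
          exact ⟨⟨hedge, fun _ => hn⟩, hdup _ _ _ ih2 hd hedge⟩
        · rw [if_neg hd] at hn
          have h := hmove _ _ ih2 hd
          rw [← hn] at h
          exact ⟨⟨h.1, fun hd' => absurd hd' hd⟩, h.2⟩
      refine ⟨fun k hk => ?_, hall.2.1, fun k hk => ?_⟩
      · by_cases h : k = n
        · rw [h]
          exact hall.1
        · exact ih1 k (by omega)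
      · by_cases h : k = n
        · rw [h]
          exact hall.2.2
        · exact ih3 k (by omega)
  have hwin := hτ2 ρ hρ0 fun k => (hinv (k + 1)).1 k (Nat.lt_succ_self k)
  have hdec := fun k => (hinv (k + 1)).2.2 k (Nat.lt_succ_self k)
  let o : ℕ → Ordinal := fun n => O (historyFlag A (pref ρ n)) (ρ n)
  have hanti : Antitone o := antitone_nat_of_succ_le fun k => (hdec k).1
  obtain ⟨N, hN⟩ : ∃ N, ∀ n, o N ≤ o n := by
    obtain ⟨N, hN⟩ := WellFounded.has_min (wellFounded_lt (α := Ordinal)) (Set.range o) ⟨_, 0, rfl⟩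
    obtain ⟨N, rfl⟩ := hN.1
    exact ⟨N, fun n => not_lt.1 (hN.2 _ ⟨n, rfl⟩)⟩
  -- From `N` on the ordinal is constant, so an unset flag would have to stay unset while `M` drops
  -- at every move.
  have hflag : ∀ k n, M (ρ n) ≤ k → N ≤ n → historyFlag A (pref ρ n) := by
    intro k
    induction k with
    | zero =>
      intro n hk hn
      by_contra hf
      rcases (hdec n).2 hf with h | h
      · exact absurd ((hanti hn).trans (hN (n + 1))) (not_le.2 h)
      · omega
    | succ k ih =>
      intro n hk hn
      by_contra hf
      rcases (hdec n).2 hf with h | h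
      · exact absurd ((hanti hn).trans (hN (n + 1))) (not_le.2 h)
      · exact h.1 (ih (n + 1) (by omega) (by omega))
  obtain ⟨i, hi, hi'⟩ := exists_unanswered A (p := fun n => (ρ n).alt) (q := fun n => (ρ n).dom)
    (f := fun n => historyFlag A (pref ρ n))
    (fun h => by
      have : historyFlag A (pref ρ 0) = False := A.pending_init
      exact absurd h (by rw [this]; exact not_false))
    (historyFlag_pref_succ A ρ) (T := N) fun n hn => hflag _ n le_rfl hn
  obtain ⟨i', h1, h2⟩ := hwin i hi
  exact hi' i' h1 h2

theorem duplicatorWins_of_not_beats [Finite Q] {A : ACA Var Q} {x y : ℕ → Finset Var}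
    (h : ¬ Beats A x y) : DuplicatorWins A x y := by
  obtain ⟨m, hm⟩ := SpoilerForces.exists_measure A x y
  let T : ℕ → Q → Q → Prop → Q → Q → Prop := fun j p q f p' q' =>
    ¬ SpoilerForces A x y (j + 1) (p', q', A.pending p' q' f) ∧
      (f → m (j + 1) (p', q', A.pending p' q' f) < m j (p, q, f))
  -- The first conjunct says that the flag is settled: moves inside a round keep both states and
  -- hence the flag.
  let Inv : Prop → Pos Q → Prop := fun f v => A.pending v.alt v.dom f = f ∧
    match v with
    | .spExists p q j => ¬ SpoilerForces A x y j (p, q, f)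
    | .dupExists p q c j => ∃ c' ∈ A.step q (y j), ∀ q' ∈ c', ∃ p' ∈ c, T j p q f p' q'
    | .spForall p q c c' j => ∀ q' ∈ c', ∃ p' ∈ c, T j p q f p' q'
    | .dupForall p q c q' j => ∃ p' ∈ c, T j p q f p' q'
  -- The offsets count the moves left in the round, and a drop of `m` by one pays for the four moves
  -- of a new round. The flag argument is `True` because progress is only required while the flag is
  -- set.
  let M : Pos Q → ℕ := fun v =>
    match v with
    | .spExists p q j => 4 * m j (p, q, True) + 3
    | .dupExists p q _ j => 4 * m j (p, q, True) + 2
    | .spForall p q _ _ j => 4 * m j (p, q, True) + 1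
    | .dupForall p q _ _ j => 4 * m j (p, q, True)
  refine duplicatorWins_of_invariant Inv M ⟨A.pending_init, h⟩ ?_ ?_
  · rintro f (⟨p, q, j⟩ | ⟨p, q, c, j⟩ | ⟨p, q, c, c', j⟩ | ⟨p, q, c, q', j⟩) ⟨hf, hinv⟩ hd
    · exact hd.elim
    · obtain ⟨c', hc', h⟩ := hinv
      have hf' : A.pending p q f = f := hf
      refine ⟨.spForall p q c c' j, .chooseDomSet hc', ?_, fun _ _ => ?_⟩
      · simp only [Pos.alt, Pos.dom, hf']
        exact ⟨hf, h⟩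
      · exact Nat.lt_succ_self _
    · exact hd.elim
    · obtain ⟨p', hp', h1, h2⟩ := hinv
      refine ⟨.spExists p' q' (j + 1), .chooseAltState hp', ⟨A.pending_idem _ _ _, h1⟩, ?_⟩
      intro hf1 hf2
      have h3 := h2 hf1
      have e1 : f = True := eq_true hf1
      have e2 : A.pending p' q' f = True := eq_true hf2
      rw [e2, e1] at h3
      show 4 * m (j + 1) (p', q', True) + 3 < 4 * m j (p, q, True)
      omega
  · rintro f v v' ⟨hf, hinv⟩ hd hedge
    cases hedge with
    | @chooseAltSet p q j c hc =>
      have hf' : A.pending p q f = f := hf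
      refine ⟨?_, fun _ _ => Nat.lt_succ_self _⟩
      simp only [Pos.alt, Pos.dom, hf']
      exact ⟨hf, hm j p q f hinv c hc⟩
    | chooseDomSet _ => exact (hd trivial).elim
    | @chooseDomState p q q' j c c' hq' =>
      have hf' : A.pending p q f = f := hf
      refine ⟨?_, fun _ _ => Nat.lt_succ_self _⟩
      simp only [Pos.alt, Pos.dom, hf']
      exact ⟨hf, hinv q' hq'⟩
    | chooseAltState _ => exact (hd trivial).elim

theorem not_duplicatorWins_of_beats {A : ACA Var Q} {x y : ℕ → Finset Var}
    (h : Beats A x y) : ¬ DuplicatorWins A x y := by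
  obtain ⟨ρ, hρ⟩ := SpoilerForces.exists_rank A x y
  let T : ℕ → Q → Q → Prop → Q → Q → Prop := fun j p q f p' q' =>
    SpoilerForces A x y (j + 1) (p', q', A.pending p' q' f) ∧
      ρ (j + 1) (p', q', A.pending p' q' f) ≤ ρ j (p, q, f) ∧
      (¬ f → ρ (j + 1) (p', q', A.pending p' q' f) < ρ j (p, q, f))
  let Inv : Prop → Pos Q → Prop := fun f v => A.pending v.alt v.dom f = f ∧
    match v with
    | .spExists p q j => SpoilerForces A x y j (p, q, f)
    | .dupExists p q c j => ∀ c' ∈ A.step q (y j), ∃ q' ∈ c', ∀ p' ∈ c, T j p q f p' q'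
    | .spForall p q c c' j => ∃ q' ∈ c', ∀ p' ∈ c, T j p q f p' q'
    | .dupForall p q c q' j => ∀ p' ∈ c, T j p q f p' q'
  let O : Prop → Pos Q → Ordinal := fun f v =>
    match v with
    | .spExists p q j => ρ j (p, q, f)
    | .dupExists p q _ j => ρ j (p, q, f)
    | .spForall p q _ _ j => ρ j (p, q, f)
    | .dupForall p q _ _ j => ρ j (p, q, f)
  let M : Pos Q → ℕ := fun v =>
    match v with
    | .spExists _ _ _ => 3
    | .dupExists _ _ _ _ => 2
    | .spForall _ _ _ _ _ => 1
    | .dupForall _ _ _ _ _ => 0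
  refine not_duplicatorWins_of_invariant Inv O M ⟨A.pending_init, h⟩ ?_ ?_
  · rintro f (⟨p, q, j⟩ | ⟨p, q, c, j⟩ | ⟨p, q, c, c', j⟩ | ⟨p, q, c, q', j⟩) ⟨hf, hinv⟩ hd
    · obtain ⟨c, hc, h⟩ := hρ j p q f hinv
      have hf' : A.pending p q f = f := hf
      refine ⟨.dupExists p q c j, .chooseAltSet hc, ?_⟩
      simp only [Pos.alt, Pos.dom, hf']
      exact ⟨⟨hf, h⟩, le_rfl, fun hn => Or.inr ⟨hn, Nat.lt_succ_self _⟩⟩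
    · exact (hd trivial).elim
    · obtain ⟨q', hq', h⟩ := hinv
      have hf' : A.pending p q f = f := hf
      refine ⟨.dupForall p q c q' j, .chooseDomState hq', ?_⟩
      simp only [Pos.alt, Pos.dom, hf']
      exact ⟨⟨hf, h⟩, le_rfl, fun hn => Or.inr ⟨hn, Nat.lt_succ_self _⟩⟩
    · exact (hd trivial).elim
  · rintro f v v' ⟨hf, hinv⟩ hd hedge
    cases hedge with
    | chooseAltSet _ => exact hd.elim
    | @chooseDomSet p q j c c' hc' =>
      have hf' : A.pending p q f = f := hf
      simp only [Pos.alt, Pos.dom, hf']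
      exact ⟨⟨hf, hinv c' hc'⟩, le_rfl, fun hn => Or.inr ⟨hn, Nat.lt_succ_self _⟩⟩
    | chooseDomState _ => exact hd.elim
    | @chooseAltState p q p' q' j c hp' =>
      obtain ⟨h1, h2, h3⟩ := hinv p' hp'
      exact ⟨⟨A.pending_idem _ _ _, h1⟩, h2, fun hn => Or.inl (h3 hn)⟩

theorem duplicatorWins_iff_not_beats [Finite Q] {A : ACA Var Q} {x y : ℕ → Finset Var} :
    DuplicatorWins A x y ↔ ¬ Beats A x y :=
  ⟨fun h h' => not_duplicatorWins_of_beats h' h, duplicatorWins_of_not_beats⟩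

end Determinacy

/-! ### Simultaneous plays -/

theorem exists_run {S : Type*} (I : ℕ → S → Prop) (R : ℕ → S → S → Prop) (s₀ : S) (h0 : I 0 s₀)
    (h : ∀ j s, I j s → ∃ s', I (j + 1) s' ∧ R j s s') :
    ∃ u : ℕ → S, u 0 = s₀ ∧ ∀ j, R j (u j) (u (j + 1)) := by
  have : Nonempty S := ⟨s₀⟩
  choose! g hg using h
  let u : ℕ → S := fun n => Nat.rec s₀ (fun j s => g j s) n
  have hu : ∀ j, I j (u j) := by
    intro j
    induction j with
    | zero => exact h0
    | succ j ih => exact (hg j (u j) ih).1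
  exact ⟨u, rfl, fun j => (hg j (u j) (hu j)).2⟩

theorem eventually_of_ordinal_descent {f : ℕ → Prop} {o : ℕ → Ordinal.{u}}
    (h1 : ∀ n, o (n + 1) ≤ o n) (h2 : ∀ n, ¬ f n → o (n + 1) < o n) :
    ∃ T, ∀ n, T ≤ n → f n := by
  obtain ⟨T, hT⟩ : ∃ T, ∀ n, o T ≤ o n := by
    obtain ⟨_, ⟨T, rfl⟩, hT⟩ :=
      WellFounded.has_min (wellFounded_lt (α := Ordinal.{u})) (Set.range o) ⟨_, 0, rfl⟩
    exact ⟨T, fun n => not_lt.1 (hT _ ⟨n, rfl⟩)⟩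
  refine ⟨T, fun n hn => ?_⟩
  by_contra hf
  exact absurd (((antitone_nat_of_succ_le h1) hn).trans (hT (n + 1))) (not_le.2 (h2 n hf))

theorem not_eventually_of_nat_descent {f : ℕ → Prop} {m : ℕ → ℕ}
    (h : ∀ n, f n → m (n + 1) < m n) : ¬ ∃ T, ∀ n, T ≤ n → f n := by
  rintro ⟨T, hT⟩
  have hdec : ∀ k, m (T + k) + k ≤ m T := by
    intro k
    induction k with
    | zero => exact le_rfl
    | succ k ih =>
      have := h (T + k) (hT _ (by omega))
      rw [Nat.add_assoc] at this
      omega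
  have := hdec (m T + 1)
  omega

section Order

variable {Var Q : Type*} [DecidableEq Var]

/-- Delay-dominance of words is transitive, in contrapositive form. -/
theorem Beats.trans_or [Finite Q] {A : ACA Var Q} {x z : ℕ → Finset Var} (h : Beats A x z)
    (y : ℕ → Finset Var) : Beats A x y ∨ Beats A y z := by
  by_contra! hcon
  obtain ⟨hxy, hyz⟩ := hcon
  obtain ⟨ρ, hρ⟩ := SpoilerForces.exists_rank A x z
  obtain ⟨m, hm⟩ := SpoilerForces.exists_measure A x y
  obtain ⟨m', hm'⟩ := SpoilerForces.exists_measure A y z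
  obtain ⟨u, hu0, hu⟩ := exists_run (S := (Q × Q × Q) × Prop × Prop × Prop)
    (fun j ⟨⟨a, b, c⟩, f, g, k⟩ => SpoilerForces A x z j (a, c, f) ∧
      ¬ SpoilerForces A x y j (a, b, g) ∧ ¬ SpoilerForces A y z j (b, c, k))
    (fun j ⟨⟨a, b, c⟩, f, g, k⟩ ⟨⟨a', b', c'⟩, f', g', k'⟩ =>
      (f' = A.pending a' c' f ∧ g' = A.pending a' b' g ∧ k' = A.pending b' c' k) ∧
      (ρ (j + 1) (a', c', f') ≤ ρ j (a, c, f) ∧ (¬ f → ρ (j + 1) (a', c', f') < ρ j (a, c, f))) ∧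
      (g → m (j + 1) (a', b', g') < m j (a, b, g)) ∧
      (k → m' (j + 1) (b', c', k') < m' j (b, c, k)))
    ((A.init, A.init, A.init), False, False, False) ⟨h, hxy, hyz⟩ (by
      rintro j ⟨⟨a, b, c⟩, f, g, k⟩ ⟨h1, h2, h3⟩
      -- Spoiler's conjunction for `x` passes through both Duplicators to `z`; the state chosen by
      -- Spoiler for `z` then passes back through them to `x`.
      obtain ⟨cx, hcx, hx⟩ := hρ j a c f h1
      obtain ⟨cy, hcy, hy⟩ := hm j a b g h2 cx hcx
      obtain ⟨cz, hcz, hz⟩ := hm' j b c k h3 cy hcy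
      obtain ⟨c', hc', hx'⟩ := hx cz hcz
      obtain ⟨b', hb', hz1, hz2⟩ := hz c' hc'
      obtain ⟨a', ha', hy1, hy2⟩ := hy b' hb'
      obtain ⟨hx1, hx2, hx3⟩ := hx' a' ha'
      exact ⟨⟨⟨a', b', c'⟩, _, _, _⟩, ⟨hx1, hy1, hz1⟩, ⟨rfl, rfl, rfl⟩, ⟨hx2, hx3⟩, hy2, hz2⟩)
  obtain ⟨T, hT⟩ := eventually_of_ordinal_descent (f := fun n => (u n).2.1)
    (o := fun n => ρ n ((u n).1.1, (u n).1.2.2, (u n).2.1))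
    (fun n => (hu n).2.1.1) (fun n => (hu n).2.1.2)
  obtain ⟨i, hi, hi'⟩ := exists_unanswered A (p := fun n => (u n).1.1) (q := fun n => (u n).1.2.2)
    (f := fun n => (u n).2.1) (fun h => by rw [hu0] at h; exact h.elim) (fun n => (hu n).1.1) hT
  -- A later rejecting state of `y` would stay unanswered by `x`, against Duplicator in the first
  -- game. Without one, the rejecting state of `z` at `i` stays unanswered by `y`.
  have hy : ∀ n, i ≤ n → (u n).1.2.1 ∉ A.rej := by
    intro n hn hrej
    refine not_eventually_of_nat_descent (f := fun n => (u n).2.2.1)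
      (m := fun n => m n ((u n).1.1, (u n).1.2.1, (u n).2.2.1)) (fun n => (hu n).2.2.1) ⟨n, ?_⟩
    exact fun l hl => flag_of_unanswered A (p := fun n => (u n).1.1) (q := fun n => (u n).1.2.1)
      (f := fun n => (u n).2.2.1) (fun h h' => by simp only [hu0] at h h'; exact absurd h h')
      (fun n => (hu n).1.2.1) hrej (fun l hl => hi' l (hn.trans hl)) hl
  refine not_eventually_of_nat_descent (f := fun n => (u n).2.2.2)
    (m := fun n => m' n ((u n).1.2.1, (u n).1.2.2, (u n).2.2.2)) (fun n => (hu n).2.2.2) ⟨i, ?_⟩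
  exact fun l hl => flag_of_unanswered A (p := fun n => (u n).1.2.1) (q := fun n => (u n).1.2.2)
    (f := fun n => (u n).2.2.2) (fun h h' => by simp only [hu0] at h h'; exact absurd h h')
    (fun n => (hu n).1.2.2) hi hy hl

/-! ### Runs that get stuck -/

/-- On the word `x`, the universal player can force the automaton into a state without transitions
within `n` rounds from state `q` at time `j`. -/
def DiesWithin (A : ACA Var Q) (x : ℕ → Finset Var) : ℕ → ℕ → Q → Prop
  | 0, _, _ => False
  | n + 1, j, q => ∀ c ∈ A.step q (x j), ∃ q' ∈ c, DiesWithin A x n (j + 1) q'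

theorem DiesWithin.succ {A : ACA Var Q} {x : ℕ → Finset Var} {n j : ℕ} {q : Q}
    (h : DiesWithin A x n j q) : DiesWithin A x (n + 1) j q := by
  induction n generalizing j q with
  | zero => exact h.elim
  | succ n ih =>
    intro c hc
    obtain ⟨q', hq', h'⟩ := h c hc
    exact ⟨q', hq', ih h'⟩

theorem DiesWithin.mono {A : ACA Var Q} {x : ℕ → Finset Var} {m n j : ℕ} {q : Q} (hmn : m ≤ n)
    (h : DiesWithin A x m j q) : DiesWithin A x n j q := by
  induction n, hmn using Nat.le_induction with
  | base => exact h
  | succ n _ ih => exact ih.succ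

theorem DiesWithin.congr {A : ACA Var Q} {x y : ℕ → Finset Var} {n j : ℕ} {q : Q}
    (hxy : ∀ i, i < j + n → x i = y i) (h : DiesWithin A x n j q) : DiesWithin A y n j q := by
  induction n generalizing j q with
  | zero => exact h.elim
  | succ n ih =>
    intro c hc
    rw [← hxy j (by omega)] at hc
    obtain ⟨q', hq', h'⟩ := h c hc
    exact ⟨q', hq', ih (fun i hi => hxy i (by omega)) h'⟩

/-- Compactness: if each of the finitely many conjunctions had a state that dies in bounded time,
the maximum of the bounds would bound the death of `q`. -/
theorem exists_survivors {A : ACA Var Q} {x : ℕ → Finset Var} {j : ℕ} {q : Q}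
    (h : ∀ n, ¬ DiesWithin A x n j q) :
    ∃ c ∈ A.step q (x j), ∀ q' ∈ c, ∀ n, ¬ DiesWithin A x n (j + 1) q' := by
  by_contra! hcon
  have : ∀ c, ∃ n, c ∈ A.step q (x j) → ∃ q' ∈ c, DiesWithin A x n (j + 1) q' := by
    intro c
    by_cases hc : c ∈ A.step q (x j)
    · obtain ⟨q', hq', n, hn⟩ := hcon c hc
      exact ⟨n, fun _ => ⟨q', hq', hn⟩⟩
    · exact ⟨0, fun h => absurd h hc⟩
  choose N hN using this
  refine h ((A.step q (x j)).sup N + 1) fun c hc => ?_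
  obtain ⟨q', hq', h'⟩ := hN c hc
  exact ⟨q', hq', h'.mono (Finset.le_sup hc)⟩

/-- Spoiler keeps the alternative run alive while driving the dominant run into a dead end. -/
theorem spoilerForces_of_diesWithin {A : ACA Var Q} {x y : ℕ → Finset Var} {n j : ℕ} {p q : Q}
    {f : Prop} (hq : DiesWithin A y n j q) (hp : ¬ DiesWithin A x n j p) :
    SpoilerForces A x y j (p, q, f) := by
  induction n generalizing j p q f with
  | zero => exact hq.elim
  | succ n ih =>
    simp only [DiesWithin, not_forall, not_exists, not_and] at hp
    obtain ⟨c, hc, hp⟩ := hp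
    refine Forced.fold (monoOps_roundOps A x y) ⟨c, hc, fun c' hc' => ?_⟩
    obtain ⟨q', hq', h⟩ := hq c' hc'
    exact ⟨q', hq', fun p' hp' => ⟨fun _ => ih h (hp p' hp'), fun _ => ih h (hp p' hp')⟩⟩

/-- Spoiler moves first in a round and so loses when both runs get stuck in the same one; hence the
bounds `n + 1` and `n`. -/
theorem not_spoilerForces_of_diesWithin {A : ACA Var Q} {x y : ℕ → Finset Var} {n j : ℕ} {p q : Q}
    {f : Prop} (hp : DiesWithin A x (n + 1) j p) (hq : ¬ DiesWithin A y n j q) :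
    ¬ SpoilerForces A x y j (p, q, f) := by
  induction n generalizing j p q f with
  | zero =>
    intro h
    obtain ⟨c, hc, -⟩ := h.unfold (monoOps_roundOps A x y)
    obtain ⟨_, _, h'⟩ := hp c hc
    exact h'
  | succ n ih =>
    intro h
    obtain ⟨c, hc, h1⟩ := h.unfold (monoOps_roundOps A x y)
    obtain ⟨p', hp', h2⟩ := hp c hc
    simp only [DiesWithin, not_forall, not_exists, not_and] at hq
    obtain ⟨c', hc', h3⟩ := hq
    obtain ⟨q', hq', h4⟩ := h1 c' hc'
    have h5 := h4 p' hp'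
    by_cases hf : f
    · exact ih h2 (h3 q' hq') (h5.1 hf)
    · exact ih h2 (h3 q' hq') (h5.2 hf)

/-- A word that gets stuck is not beaten by a word that does not beat some word with the same
prefix up to the time where it is stuck. -/
theorem not_beats_of_diesWithin {A : ACA Var Q} {x y w : ℕ → Finset Var} {n : ℕ}
    (hw : DiesWithin A w n 0 A.init) (hy : ∀ i < n, y i = w i) (hxy : ¬ Beats A x y) :
    ¬ Beats A x w := by
  classical
  have hex : ∃ n, DiesWithin A w n 0 A.init := ⟨n, hw⟩
  have hle : Nat.find hex ≤ n := Nat.find_min' hex hw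
  have hlast := Nat.find_spec hex
  have hmin := fun k => Nat.find_min (H := hex) (m := k)
  generalize Nat.find hex = N at hle hlast hmin
  cases N with
  | zero => exact hlast.elim
  | succ N =>
    have hyd : DiesWithin A y (N + 1) 0 A.init :=
      hlast.congr fun i hi => (hy i (by omega)).symm
    have hxd : DiesWithin A x (N + 1) 0 A.init := by
      by_contra hx
      exact hxy (spoilerForces_of_diesWithin hyd hx)
    exact not_spoilerForces_of_diesWithin hxd (hmin N (Nat.lt_succ_self N))

/-- There is no infinite sequence of words, each one beating its predecessor, that starts with a word
on which the automaton does not get stuck. -/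
theorem not_forall_beats_succ {A : ACA Var Q} {u : ℕ → ℕ → Finset Var}
    (h0 : ∀ n, ¬ DiesWithin A (u 0) n 0 A.init) : ¬ ∀ n, Beats A (u (n + 1)) (u n) := by
  intro hb
  choose ρ hρ using fun n => SpoilerForces.exists_rank A (u (n + 1)) (u n)
  obtain ⟨r, hr0, hr⟩ := exists_run (S := (ℕ → Q) × (ℕ → Prop))
    (fun j s => (∀ n, ¬ DiesWithin A (u 0) n j (s.1 0)) ∧
      ∀ n, SpoilerForces A (u (n + 1)) (u n) j (s.1 (n + 1), s.1 n, s.2 n))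
    (fun j s s' => ∀ n, s'.2 n = A.pending (s'.1 (n + 1)) (s'.1 n) (s.2 n) ∧
      ρ n (j + 1) (s'.1 (n + 1), s'.1 n, s'.2 n) ≤ ρ n j (s.1 (n + 1), s.1 n, s.2 n) ∧
      (¬ s.2 n →
        ρ n (j + 1) (s'.1 (n + 1), s'.1 n, s'.2 n) < ρ n j (s.1 (n + 1), s.1 n, s.2 n)))
    (fun _ => A.init, fun _ => False) ⟨h0, hb⟩ (by
      rintro j ⟨s, f⟩ ⟨hs0, hs⟩
      obtain ⟨c₀, hc₀, hsurv⟩ := exists_survivors hs0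
      choose c hc hmove using fun n => hρ n j _ _ _ (hs n)
      -- Spoiler's conjunction for `u (n + 1)` in game `n` is Duplicator's choice in game `n + 1`.
      -- Only `u 0` needs one from outside, which is why it must not get stuck.
      let d : ℕ → Finset Q := fun n => Nat.casesOn n c₀ c
      have hd : ∀ n, d n ∈ A.step (s n) (u n j) := fun n => by
        cases n with
        | zero => exact hc₀
        | succ n => exact hc n
      -- Spoiler picks the dominant state before the alternative one is known, so all states can be
      -- chosen at once, without circularity.
      choose s' hs' hmove' using fun n => hmove n (d n) (hd n)
      exact ⟨⟨s', fun n => A.pending (s' (n + 1)) (s' n) (f n)⟩,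
        ⟨hsurv _ (hs' 0), fun n => (hmove' n (s' (n + 1)) (hs' (n + 1))).1⟩,
        fun n => ⟨rfl, (hmove' n (s' (n + 1)) (hs' (n + 1))).2⟩⟩)
  have hlast : ∀ n, ∃ i, (r i).1 n ∈ A.rej ∧ ∀ l, i ≤ l → (r l).1 (n + 1) ∉ A.rej := by
    intro n
    obtain ⟨T, hT⟩ := eventually_of_ordinal_descent (f := fun l => (r l).2 n)
      (o := fun l => ρ n l ((r l).1 (n + 1), (r l).1 n, (r l).2 n))
      (fun l => (hr l n).2.1) (fun l => (hr l n).2.2)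
    exact exists_unanswered A (p := fun l => (r l).1 (n + 1)) (q := fun l => (r l).1 n)
      (f := fun l => (r l).2 n) (fun h => by rw [hr0] at h; exact h.elim)
      (fun l => (hr l n).1) hT
  choose i hi hi' using hlast
  have hdec : ∀ n, i (n + 1) < i n := fun n => by
    by_contra hle
    exact hi' n _ (not_lt.1 hle) (hi (n + 1))
  exact not_eventually_of_nat_descent (f := fun _ => True) (m := i) (fun n _ => hdec n)
    ⟨0, fun _ _ => trivial⟩

end Order

/-! ### Delay-dominant strategies against arbitrary words -/

section Respond

variable {Var Q : Type*}

theorem Strategy.stateAt_congr {I O : Finset Var} (s : Strategy I O) {γ γ' : ℕ → Finset Var} {n : ℕ}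
    (h : ∀ m < n, γ m = γ' m) : s.stateAt γ n = s.stateAt γ' n := by
  induction n with
  | zero => rfl
  | succ n ih =>
    simp only [Strategy.stateAt, ih fun m hm => h m (by omega), h n (Nat.lt_succ_self n)]

variable [DecidableEq Var] {I O : Finset Var}

/-- A delay-dominant strategy delay-dominates all words with the same inputs, not just the
computations of finite-state strategies. -/
theorem IsDelayDominant.not_beats_comp [Finite Q] {A : ACA Var Q} {s : Strategy I O}
    (hs : IsDelayDominant A s) {γ o : ℕ → Finset Var} (hγ : IsWordOver I γ) (ho : IsWordOver O o) :
    ¬ Beats A (fun n => γ n ∪ o n) (s.comp γ) := by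
  intro h
  have := s.finite
  obtain ⟨a, d, hd, hstate, hforced⟩ :=
    Forced.exists_lasso (monoOps_roundOps A (fun n => γ n ∪ o n) (s.comp γ)) (s.stateAt γ) h
  let γ' : ℕ → Finset Var := fun n => γ (lasso a d n)
  -- This machine ignores its inputs and replays `o` along the lasso.
  let t : Strategy I O :=
    { State := Fin (a + d)
      finite := inferInstance
      init := ⟨0, by omega⟩
      trans := fun i _ => ⟨lasso a d (i + 1), lasso_lt hd _⟩
      out := fun i => o i
      out_subset := fun i => ho i }
  have ht : ∀ n, ((t.stateAt γ' n : Fin (a + d)) : ℕ) = lasso a d n := by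
    intro n
    induction n with
    | zero => exact (lasso_of_lt (by omega)).symm
    | succ n ih =>
      show lasso a d (((t.stateAt γ' n : Fin (a + d)) : ℕ) + 1) = _
      rw [ih, lasso_lasso_succ hd]
  -- `s` is in the same state at both ends of the period, so its run on the folded inputs is the
  -- folded run.
  have hst : ∀ n, s.stateAt γ' n = s.stateAt γ (lasso a d n) := by
    intro n
    induction n with
    | zero => rw [lasso_of_lt (by omega)]; rfl
    | succ n ih =>
      have h1 : s.stateAt γ' (n + 1) = s.stateAt γ (lasso a d n + 1) := by
        simp only [Strategy.stateAt, ih, γ']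
      rw [h1, lasso_succ hd]
      have hlt := lasso_lt (a := a) hd n
      split_ifs with h'
      · rfl
      · rw [← hstate, show lasso a d n + 1 = a + d by omega]
  have hcomp_s : s.comp γ' = fun n => s.comp γ (lasso a d n) := by
    funext n
    simp only [Strategy.comp, hst, γ']
  have hcomp_t : t.comp γ' = fun n => γ (lasso a d n) ∪ o (lasso a d n) := by
    funext n
    show γ' n ∪ o ((t.stateAt γ' n : Fin (a + d)) : ℕ) = _
    rw [ht]
  have hdom := hs t γ' fun n => hγ _
  unfold DominatesOn at hdom
  rw [hcomp_s, hcomp_t, duplicatorWins_iff_not_beats] at hdom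
  exact hdom hforced

/-- The word obtained from `x` by replacing the outputs by the reaction of `s` to the inputs. -/
def Strategy.respond (s : Strategy I O) (x : ℕ → Finset Var) : ℕ → Finset Var :=
  fun n => (x n \ O) ∪ s.out (s.stateAt (fun m => x m ∩ I) n)

theorem IsDelayDominant.not_beats_respond [Finite Q] {A : ACA Var Q} {s : Strategy I O}
    (hs : IsDelayDominant A s) (hdisj : Disjoint I O) (hA : A.props ⊆ I ∪ O) (x : ℕ → Finset Var) :
    ¬ Beats A x (s.respond x) := by
  intro h
  refine hs.not_beats_comp (γ := fun n => x n ∩ I) (o := fun n => x n ∩ O)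
    (fun n => Finset.inter_subset_right) (fun n => Finset.inter_subset_right)
    (Beats.congr (fun n => ?_) (fun n => ?_) h)
  · ext v
    have hv := @hA v
    simp only [Finset.mem_inter, Finset.mem_union] at hv ⊢
    tauto
  · ext v
    have hv := @hA v
    have hd : v ∈ I → v ∉ O := fun h => Finset.disjoint_left.1 hdisj h
    have ho := Finset.mem_of_subset (a := v) (s.out_subset (s.stateAt (fun m => x m ∩ I) n))
    simp only [Strategy.respond, Strategy.comp, Finset.mem_inter, Finset.mem_union,
      Finset.mem_sdiff] at hv ho ⊢
    tauto

end Respond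

/-! ### Two strategies responding to each other -/

section Composition

variable {Var Q : Type*} [DecidableEq Var] {I₁ O₁ I₂ O₂ : Finset Var}

/-- The words over the variables of the composition with inputs `γ`. -/
def HasInputs (I O : Finset Var) (γ x : ℕ → Finset Var) : Prop :=
  ∀ n, x n ⊆ I ∪ O ∧ x n ∩ I = γ n

/-- Let first `s₁` and then `s₂` respond. -/
def respondBoth (s₁ : Strategy I₁ O₁) (s₂ : Strategy I₂ O₂) (x : ℕ → Finset Var) :
    ℕ → Finset Var :=
  s₂.respond (s₁.respond x)

/-- The Moore property: the output at time `n` depends only on earlier letters. This lets each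
mutual response correct one more letter. -/
theorem respond_eq_of_prefix {I O : Finset Var} (s : Strategy I O) {x y : ℕ → Finset Var} {n : ℕ}
    (h : ∀ m < n, x m = y m) :
    s.respond x n = (x n \ O) ∪ s.out (s.stateAt (fun m => y m ∩ I) n) := by
  unfold Strategy.respond
  rw [s.stateAt_congr (γ' := fun m => y m ∩ I) fun m hm => by simp only [h m hm]]

theorem par_stateAt (h₁ : Disjoint I₁ O₁) (h₂ : Disjoint I₂ O₂)
    (s₁ : Strategy I₁ O₁) (s₂ : Strategy I₂ O₂) (γ : ℕ → Finset Var) (n : ℕ) :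
    (s₁.par s₂).stateAt γ n =
      (s₁.stateAt (fun m => (s₁.par s₂).comp γ m ∩ I₁) n,
        s₂.stateAt (fun m => (s₁.par s₂).comp γ m ∩ I₂) n) := by
  induction n with
  | zero => rfl
  | succ n ih =>
    have e₁ : ∀ t : s₁.State × s₂.State,
        (γ n ∪ s₂.out t.2) ∩ I₁ = (γ n ∪ (s₁.out t.1 ∪ s₂.out t.2)) ∩ I₁ := by
      intro t
      ext v
      have ho := Finset.mem_of_subset (a := v) (s₁.out_subset t.1)
      have hd : v ∈ I₁ → v ∉ O₁ := fun h => Finset.disjoint_left.1 h₁ h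
      simp only [Finset.mem_inter, Finset.mem_union]
      tauto
    have e₂ : ∀ t : s₁.State × s₂.State,
        (γ n ∪ s₁.out t.1) ∩ I₂ = (γ n ∪ (s₁.out t.1 ∪ s₂.out t.2)) ∩ I₂ := by
      intro t
      ext v
      have ho := Finset.mem_of_subset (a := v) (s₂.out_subset t.2)
      have hd : v ∈ I₂ → v ∉ O₂ := fun h => Finset.disjoint_left.1 h₂ h
      simp only [Finset.mem_inter, Finset.mem_union]
      tauto
    have hstep : ∀ t : s₁.State × s₂.State, (s₁.par s₂).trans t (γ n) =
        (s₁.trans t.1 ((γ n ∪ (s₁.par s₂).out t) ∩ I₁),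
          s₂.trans t.2 ((γ n ∪ (s₁.par s₂).out t) ∩ I₂)) := fun t =>
      congrArg₂ Prod.mk (congrArg (s₁.trans t.1) (e₁ t)) (congrArg (s₂.trans t.2) (e₂ t))
    exact (hstep _).trans (congrArg₂ Prod.mk
      (congrArg (fun t => s₁.trans t ((s₁.par s₂).comp γ n ∩ I₁)) (congrArg Prod.fst ih))
      (congrArg (fun t => s₂.trans t ((s₁.par s₂).comp γ n ∩ I₂)) (congrArg Prod.snd ih)))

theorem hasInputs_comp {I O : Finset Var} (hdisj : Disjoint I O) (s : Strategy I O)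
    {γ : ℕ → Finset Var} (hγ : IsWordOver I γ) : HasInputs I O γ (s.comp γ) := by
  intro n
  have ho := s.out_subset (s.stateAt γ n)
  refine ⟨Finset.union_subset_union (hγ n) ho, ?_⟩
  ext v
  have h1 := Finset.mem_of_subset (a := v) (hγ n)
  have h2 := @ho v
  have hd : v ∈ I → v ∉ O := fun h => Finset.disjoint_left.1 hdisj h
  simp only [Strategy.comp, Finset.mem_inter, Finset.mem_union]
  tauto

theorem hasInputs_respond {I O I' O' : Finset Var} (hdisj : Disjoint I O) (s : Strategy I' O')
    (hO : O' ⊆ O) {γ x : ℕ → Finset Var} (hx : HasInputs I O γ x) :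
    HasInputs I O γ (s.respond x) := by
  intro n
  obtain ⟨hx1, hx2⟩ := hx n
  rw [← hx2]
  have ho := s.out_subset (s.stateAt (fun m => x m ∩ I') n)
  refine ⟨Finset.union_subset (Finset.sdiff_subset.trans hx1)
    ((ho.trans hO).trans Finset.subset_union_right), ?_⟩
  ext v
  have h2 := @ho v
  have h3 := @hO v
  have hd : v ∈ I → v ∉ O := fun h => Finset.disjoint_left.1 hdisj h
  simp only [Strategy.respond, Finset.mem_inter, Finset.mem_union, Finset.mem_sdiff]
  tauto

/-- The mutual responses approach the computation of the parallel composition. -/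
theorem respondBoth_iterate_eq_comp (h₁ : Disjoint I₁ O₁) (h₂ : Disjoint I₂ O₂)
    (h₁₂ : Disjoint O₁ O₂) (s₁ : Strategy I₁ O₁) (s₂ : Strategy I₂ O₂) {γ x : ℕ → Finset Var}
    (hγ : IsWordOver ((I₁ ∪ I₂) \ (O₁ ∪ O₂)) γ)
    (hx : HasInputs ((I₁ ∪ I₂) \ (O₁ ∪ O₂)) (O₁ ∪ O₂) γ x) (n : ℕ) :
    HasInputs ((I₁ ∪ I₂) \ (O₁ ∪ O₂)) (O₁ ∪ O₂) γ ((respondBoth s₁ s₂)^[n] x) ∧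
      ∀ m < n, (respondBoth s₁ s₂)^[n] x m = (s₁.par s₂).comp γ m := by
  have hdisj : Disjoint ((I₁ ∪ I₂) \ (O₁ ∪ O₂)) (O₁ ∪ O₂) := Finset.sdiff_disjoint
  induction n with
  | zero => exact ⟨hx, fun m hm => absurd hm (Nat.not_lt_zero m)⟩
  | succ n ih =>
    rw [Function.iterate_succ_apply']
    obtain ⟨ih1, ih2⟩ := ih
    generalize (respondBoth s₁ s₂)^[n] x = y at ih1 ih2
    refine ⟨hasInputs_respond hdisj s₂ Finset.subset_union_right
      (hasInputs_respond hdisj s₁ Finset.subset_union_left ih1), ?_⟩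
    have hout : ∀ m, (s₁.par s₂).comp γ m =
        γ m ∪ (s₁.out (s₁.stateAt (fun m => (s₁.par s₂).comp γ m ∩ I₁) m) ∪
          s₂.out (s₂.stateAt (fun m => (s₁.par s₂).comp γ m ∩ I₂) m)) := fun m =>
      congrArg (fun t : s₁.State × s₂.State => γ m ∪ (s₁.out t.1 ∪ s₂.out t.2))
        (par_stateAt h₁ h₂ s₁ s₂ γ m)
    have hresp₁ : ∀ m ≤ n, s₁.respond y m =
        (y m \ O₁) ∪ s₁.out (s₁.stateAt (fun m => (s₁.par s₂).comp γ m ∩ I₁) m) :=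
      fun m hm => respond_eq_of_prefix s₁ fun k hk => ih2 k (by omega)
    -- The reaction of `s₁` leaves the correct prefix intact, so `s₂` also reads correct inputs
    -- before time `n` and both outputs are right at time `n`.
    have hagree : ∀ m < n, s₁.respond y m = (s₁.par s₂).comp γ m := by
      intro m hm
      rw [hresp₁ m hm.le, ih2 m hm, hout m]
      ext v
      have a1 := Finset.mem_of_subset (a := v) (s₁.out_subset (s₁.stateAt (fun m => (s₁.par s₂).comp γ m ∩ I₁) m))
      have a2 := Finset.mem_of_subset (a := v) (s₂.out_subset (s₂.stateAt (fun m => (s₁.par s₂).comp γ m ∩ I₂) m))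
      have a3 := Finset.mem_of_subset (a := v) (hγ m)
      have a4 : v ∈ O₁ → v ∉ O₂ := fun h => Finset.disjoint_left.1 h₁₂ h
      simp only [Finset.mem_union, Finset.mem_sdiff] at a3 ⊢
      tauto
    intro m hm
    have e : respondBoth s₁ s₂ y m = (s₁.respond y m \ O₂) ∪
        s₂.out (s₂.stateAt (fun m => (s₁.par s₂).comp γ m ∩ I₂) m) :=
      respond_eq_of_prefix s₂ fun k hk => hagree k (by omega)
    rw [e, hresp₁ m (by omega), hout m, ← (ih1 m).2]
    ext v
    have a1 := Finset.mem_of_subset (a := v) (s₁.out_subset (s₁.stateAt (fun m => (s₁.par s₂).comp γ m ∩ I₁) m))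
    have a2 := Finset.mem_of_subset (a := v) (s₂.out_subset (s₂.stateAt (fun m => (s₁.par s₂).comp γ m ∩ I₂) m))
    have a3 := Finset.mem_of_subset (a := v) ((ih1 m).1)
    have a4 : v ∈ O₁ → v ∉ O₂ := fun h => Finset.disjoint_left.1 h₁₂ h
    simp only [Finset.mem_union, Finset.mem_sdiff, Finset.mem_inter] at a3 ⊢
    tauto

/-- No single reaction makes a word worse, and transitivity chains them. Starting from one iteration
avoids the need for reflexivity. -/
theorem not_beats_respondBoth_iterate [Finite Q] {A : ACA Var Q} (h₁ : Disjoint I₁ O₁)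
    (h₂ : Disjoint I₂ O₂) (hA₁ : A.props ⊆ I₁ ∪ O₁) (hA₂ : A.props ⊆ I₂ ∪ O₂)
    {s₁ : Strategy I₁ O₁} {s₂ : Strategy I₂ O₂} (hs₁ : IsDelayDominant A s₁)
    (hs₂ : IsDelayDominant A s₂) (x : ℕ → Finset Var) (n : ℕ) :
    ¬ Beats A x ((respondBoth s₁ s₂)^[n + 1] x) := by
  have hstep : ∀ y, ¬ Beats A y (respondBoth s₁ s₂ y) := fun y h =>
    (h.trans_or (s₁.respond y)).elim (hs₁.not_beats_respond h₁ hA₁ y)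
      (hs₂.not_beats_respond h₂ hA₂ _)
  induction n with
  | zero => exact hstep x
  | succ n ih =>
    rw [Function.iterate_succ_apply']
    exact fun h => (h.trans_or _).elim ih (hstep _)

/-- The parallel composition of delay-dominant strategies is delay-dominant if each of its
computations that fails to delay-dominate has a bad prefix. -/
theorem IsDelayDominant.par [Finite Q] {A : ACA Var Q} (h₁ : Disjoint I₁ O₁)
    (h₂ : Disjoint I₂ O₂) (h₁₂ : Disjoint O₁ O₂) (hA₁ : A.props ⊆ I₁ ∪ O₁)
    (hA₂ : A.props ⊆ I₂ ∪ O₂) {s₁ : Strategy I₁ O₁} {s₂ : Strategy I₂ O₂}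
    (hs₁ : IsDelayDominant A s₁) (hs₂ : IsDelayDominant A s₂)
    (hbad : ∀ γ : ℕ → Finset Var, IsWordOver ((I₁ ∪ I₂) \ (O₁ ∪ O₂)) γ →
      (∃ t : Strategy ((I₁ ∪ I₂) \ (O₁ ∪ O₂)) (O₁ ∪ O₂), ¬ DominatesOn A (s₁.par s₂) t γ) →
      ∃ k : ℕ, ∀ σ : ℕ → Finset Var, IsWordOver ((I₁ ∪ I₂) \ (O₁ ∪ O₂) ∪ (O₁ ∪ O₂)) σ →
        (∀ n < k, σ n = (s₁.par s₂).comp γ n) →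
        ∃ σ' : ℕ → Finset Var, IsWordOver ((I₁ ∪ I₂) \ (O₁ ∪ O₂) ∪ (O₁ ∪ O₂)) σ' ∧
          (∀ n, σ n ∩ ((I₁ ∪ I₂) \ (O₁ ∪ O₂)) = σ' n ∩ ((I₁ ∪ I₂) \ (O₁ ∪ O₂))) ∧
          ¬ DuplicatorWins A σ' σ) :
    IsDelayDominant A (s₁.par s₂) := by
  intro t γ hγ
  by_contra hnd
  obtain ⟨k, hk⟩ := hbad γ hγ ⟨t, hnd⟩
  have hdisj : Disjoint ((I₁ ∪ I₂) \ (O₁ ∪ O₂)) (O₁ ∪ O₂) := Finset.sdiff_disjoint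
  have hbeat : Beats A (t.comp γ) ((s₁.par s₂).comp γ) := by
    by_contra h
    exact hnd (duplicatorWins_of_not_beats h)
  by_cases hdies : ∃ n, DiesWithin A ((s₁.par s₂).comp γ) n 0 A.init
  · obtain ⟨n, hn⟩ := hdies
    have hit := respondBoth_iterate_eq_comp h₁ h₂ h₁₂ s₁ s₂ hγ (hasInputs_comp hdisj t hγ) (n + 1)
    exact not_beats_of_diesWithin hn (fun i hi => hit.2 i (by omega))
      (not_beats_respondBoth_iterate h₁ h₂ hA₁ hA₂ hs₁ hs₂ (t.comp γ) n) hbeat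
  · have hnext : ∀ z, HasInputs ((I₁ ∪ I₂) \ (O₁ ∪ O₂)) (O₁ ∪ O₂) γ z →
        ∃ z', HasInputs ((I₁ ∪ I₂) \ (O₁ ∪ O₂)) (O₁ ∪ O₂) γ z' ∧ Beats A z' z := by
      intro z hz
      obtain ⟨hit1, hit2⟩ := respondBoth_iterate_eq_comp h₁ h₂ h₁₂ s₁ s₂ hγ hz (k + 1)
      obtain ⟨z', hz'1, hz'2, hz'3⟩ := hk _ (fun n => (hit1 n).1)
        fun n hn => hit2 n (by omega)
      have hb : Beats A z' ((respondBoth s₁ s₂)^[k + 1] z) := by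
        by_contra h
        exact hz'3 (duplicatorWins_of_not_beats h)
      refine ⟨z', fun n => ⟨hz'1 n, (hz'2 n).symm.trans (hit1 n).2⟩, ?_⟩
      -- The iterate of `z` has the bad prefix and is beaten by `z'`, but `z` does not beat it.
      exact (hb.trans_or z).resolve_right
        (not_beats_respondBoth_iterate h₁ h₂ hA₁ hA₂ hs₁ hs₂ z k)
    obtain ⟨u, hu0, hu⟩ := exists_run
      (fun _ z => HasInputs ((I₁ ∪ I₂) \ (O₁ ∪ O₂)) (O₁ ∪ O₂) γ z)
      (fun _ z z' => Beats A z' z) ((s₁.par s₂).comp γ) (hasInputs_comp hdisj _ hγ)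
      fun _ z hz => hnext z hz
    refine not_forall_beats_succ (A := A) (u := u) ?_ hu
    rw [hu0]
    exact not_exists.1 hdies

end Composition

/-- The bad prefixes of `EnsuresBadPrefixes` for inputs and outputs that are equal to
those of a set of processes. -/
theorem Architecture.EnsuresBadPrefixes.exists_prefix {Proc Var Q : Type*} [DecidableEq Var]
    {arch : Architecture Proc Var} {A : ACA Var Q} (hA : arch.EnsuresBadPrefixes A)
    {S : Finset Proc} (hS : S.Nonempty) {I O : Finset Var} (hI : I = arch.inputs S)
    (hO : O = arch.outputs S) (s : Strategy I O) (γ : ℕ → Finset Var) (hγ : IsWordOver I γ)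
    (ht : ∃ t : Strategy I O, ¬ DominatesOn A s t γ) :
    ∃ k : ℕ, ∀ σ : ℕ → Finset Var, IsWordOver (I ∪ O) σ → (∀ n < k, σ n = s.comp γ n) →
      ∃ σ' : ℕ → Finset Var, IsWordOver (I ∪ O) σ' ∧ (∀ n, σ n ∩ I = σ' n ∩ I) ∧
        ¬ DuplicatorWins A σ' σ := by
  subst hI hO
  exact hA S hS s γ hγ ht

end DelayDom

theorem theorem7 {Proc Var Q : Type*} [Finite Proc] [DecidableEq Var] [Finite Q]
    (arch : DelayDom.Architecture Proc Var) (A : DelayDom.ACA Var Q)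
    (hA : arch.EnsuresBadPrefixes A)
    (p₁ p₂ : Proc) (hp : p₁ ≠ p₂)
    (hA₁ : A.props ⊆ arch.vars p₁) (hA₂ : A.props ⊆ arch.vars p₂)
    (s₁ : DelayDom.Strategy (arch.inp p₁) (arch.out p₁))
    (s₂ : DelayDom.Strategy (arch.inp p₂) (arch.out p₂))
    (hs₁ : DelayDom.IsDelayDominant A s₁) (hs₂ : DelayDom.IsDelayDominant A s₂) :
    DelayDom.IsDelayDominant A (s₁.par s₂) := by
  classical
  -- The bad prefixes come from the set `{p₁, p₂}`, whose inputs and outputs equal those of `s₁.par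
  -- s₂` only propositionally.
  refine DelayDom.IsDelayDominant.par (arch.inp_disjoint_out p₁) (arch.inp_disjoint_out p₂)
    (arch.out_disjoint_out p₁ p₂ hp) hA₁ hA₂ hs₁ hs₂
    (hA.exists_prefix (S := {p₁, p₂}) (Finset.insert_nonempty _ _) ?_ ?_ _)
  · simp [DelayDom.Architecture.inputs, Finset.biUnion_insert]
  · simp [DelayDom.Architecture.outputs, Finset.biUnion_insert]
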